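/- Let $c\in\mathbb R$. Let $C(\mathbb R^+)$ be the space of bounded, uniformly continuous functions $f:(0,\infty)\to\mathbb C$. For $1\le p<\infty$ let $X^p_c$ be the space of functions $f:(0,\infty)\to\mathbb C$ with $\|f\|_{X^p_c}:=\|x^{c-1/p}f(x)\|_{L^p(0,\infty)}<\infty$, and put $\|f\|_{X^\infty_c}:=\sup_{x>0}|x^cf(x)|$. The Mellin transform of $f\in X^1_c$ is $[f]^\wedge(c+it)=\int_0^\infty u^{c+it-1}f(u)\,du$; for $f\in X^2_c$ it is the limit in $L^2(\mathbb R,dt)$ of $\int_{1/\rho}^{\rho}u^{c+it-1}f(u)\,du$ as $\rho\to\infty$. For $p\in\{1,2\}$ let $\mathcal M^p_c$ be the set of $f\in X^p_c\cap C(\mathbb R^+)$ with $[f]^\wedge(c+i\,\cdot)\in L^1(\mathbb R)$. For $r\in\mathbb N$ and $h>0$ let $(\Delta^{r,c}_hf)(u)=\sum_{j=0}^r(-1)^{r-j}\binom rj h^{jc}f(h^ju)$ and $\omega_r(f,\delta,X^p_c)=\sup_{|\log h|\le\delta}\|\Delta_h^{r,c}f\|_{X^p_c}$. For $0<\alpha\le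 r$ let $\mathrm{Lip}_r(\alpha,X^p_c)$ be the set of $f\in X^p_c$ with $\omega_r(f,\delta,X^p_c)=\mathcal O(\delta^\alpha)$ as $\delta\to0^+$, and write $\mathrm{Lip}_r(\alpha,X^1_c\cap C(\mathbb R^+)):=\mathrm{Lip}_r(\alpha,X^1_c)\cap C(\mathbb R^+)$. Let $(\Theta_cg)(x)=\lim_{h\to1}\frac{h^cg(hx)-g(x)}{h-1}$ and $\Theta_c^r=\Theta_c(\Theta_c^{r-1})$. For $r\ge1$ the Mellin–Sobolev space $W^{r,p}_c$ is the set of $f\in X^p_c$ that agree almost everywhere with some $g\in C^{r-1}(\mathbb R^+)$ (here: $g$ is $r-1$ times continuously differentiable on $(0,\infty)$) such that $g^{(r-1)}$ is locally absolutely continuous on $(0,\infty)$ and $\Theta^r_cg\in X^p_c$. Let $\mathrm{lin}_c(x)=x^{-c}\,\mathrm{sinc}(\log x)$ for $x>0$, where $\mathrm{sinc}(t)=\frac{\sin\pi t}{\pi t}$ for $t\ne0$ and $\mathrm{sinc}(0)=1$, and for $T>0$, $x>0$ define the remainder of the approximate exponential sampling formula by $$(R_{\pi T}f)(x)=f(x)-\sum_{k\in\mathbb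 Z}f(e^{k/T})\,\mathrm{lin}_{c/T}(e^{-k}x^T).$$ In each of the following cases the series converges absolutely for all $T>0$ and $x>0$, and the stated estimate holds as $T\to+\infty$ (with a constant that may depend on $f$): 1. If $f\in\mathrm{Lip}_r(\alpha,X^1_c\cap C(\mathbb R^+))$ with $r\in\mathbb N$, $r\ge2$, $1<\alpha\le r$, then $\|R_{\pi T}f\|_{X^\infty_c}=\mathcal O(T^{-\alpha+1})$. 2. If $f\in\mathcal M^2_c\cap\mathrm{Lip}_r(\beta,X^2_c)$ with $r\in\mathbb N$, $1/2<\beta\le r$, then $\|R_{\pi T}f\|_{X^\infty_c}=\mathcal O(T^{-\beta+1/2})$. 3. If $f\in\mathcal M^1_c\cap W^{r,1}_c$ with $r\in\mathbb N$, $r>1$, then $\|R_{\pi T}f\|_{X^\infty_c}=\mathcal O(T^{-r+1})$. 4. If $f\in\mathcal M^2_c\cap W^{r,2}_c$ with $r\in\mathbb N$, $r>1/2$, then $\|R_{\pi T}f\|_{X^\infty_c}=\mathcal O(T^{-r+1/2})$. -/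

import Mathlib

open MeasureTheory Filter Topology Set
open scoped ENNReal

namespace MellinSampling

noncomputable section

/-! Functions on the positive half-line are represented by functions `f : ℝ → ℂ` of which only the
values on `(0, ∞)` are ever used. -/

/-- The space of bounded and uniformly continuous functions on `(0, ∞)`. -/
def MemC (f : ℝ → ℂ) : Prop :=
  UniformContinuousOn f (Ioi 0) ∧ ∃ M : ℝ, ∀ x ∈ Ioi (0 : ℝ), ‖f x‖ ≤ M

/-- `f` belongs to `X^p_c` (for `1 ≤ p < ∞`): `x ↦ x ^ (c - 1/p) f(x)` is in `L^p(0, ∞)`. -/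
def MemX (c : ℝ) (p : ℝ≥0∞) (f : ℝ → ℂ) : Prop :=
  MemLp (fun x : ℝ => ((x ^ (c - 1 / p.toReal) : ℝ) : ℂ) * f x) p (volume.restrict (Ioi 0))

/-- The norm of `X^p_c` (for `1 ≤ p < ∞`), with values in `[0, ∞]`. -/
def normX (c : ℝ) (p : ℝ≥0∞) (f : ℝ → ℂ) : ℝ≥0∞ :=
  eLpNorm (fun x : ℝ => ((x ^ (c - 1 / p.toReal) : ℝ) : ℂ) * f x) p (volume.restrict (Ioi 0))

/-- The norm of `X^∞_c`, a true supremum over all `x > 0`, with values in `[0, ∞]`. -/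
def normXInfty (c : ℝ) (f : ℝ → ℂ) : ℝ≥0∞ :=
  ⨆ x ∈ Ioi (0 : ℝ), ‖((x ^ c : ℝ) : ℂ) * f x‖ₑ

/-- `F` is (a version of) the Mellin transform in the `X^2_c` sense of `f`, as a function of
`t ∈ ℝ ↔ c + it`: the `L^2` limit as `ρ → ∞` of the truncated Mellin integrals over `[1/ρ, ρ]`. -/
def IsMellinTransformL2 (c : ℝ) (f F : ℝ → ℂ) : Prop :=
  MemLp F 2 volume ∧
  Tendsto (fun ρ : ℝ =>
    eLpNorm (fun t : ℝ =>
      F t - ∫ u in (1 / ρ)..ρ, f u * (u : ℂ) ^ ((c : ℂ) + t * Complex.I - 1)) 2 volume)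
    atTop (𝓝 0)

/-- The class `M^1_c`: functions in `X^1_c ∩ C` whose Mellin transform is integrable on the line
`c + iℝ`. -/
def MemM1 (c : ℝ) (f : ℝ → ℂ) : Prop :=
  MemX c 1 f ∧ MemC f ∧ Integrable (fun t : ℝ => mellin f ((c : ℂ) + t * Complex.I)) volume

/-- The class `M^2_c`: functions in `X^2_c ∩ C` whose `X^2_c` Mellin transform (unique up to null
sets) is integrable on the line `c + iℝ`. -/
def MemM2 (c : ℝ) (f : ℝ → ℂ) : Prop :=
  MemX c 2 f ∧ MemC f ∧ ∃ F : ℝ → ℂ, IsMellinTransformL2 c f F ∧ Integrable F volume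

/-- The Mellin difference of order `r`. -/
def mellinDiff (r : ℕ) (c h : ℝ) (f : ℝ → ℂ) (u : ℝ) : ℂ :=
  ∑ j ∈ Finset.range (r + 1),
    (-1 : ℂ) ^ (r - j) * (r.choose j : ℂ) * f (h ^ j * u) * ((h ^ ((j : ℝ) * c) : ℝ) : ℂ)

/-- The modulus of smoothness `ω_r(f, δ, X^p_c)`, with values in `[0, ∞]`. -/
def modulus (r : ℕ) (c : ℝ) (p : ℝ≥0∞) (f : ℝ → ℂ) (δ : ℝ) : ℝ≥0∞ :=
  ⨆ h ∈ {h : ℝ | 0 < h ∧ |Real.log h| ≤ δ}, normX c p (mellinDiff r c h f)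

/-- The Mellin-Lipschitz class `Lip_r(α, X^p_c)`: `f ∈ X^p_c` and `ω_r(f, δ, X^p_c) = O(δ^α)` as
`δ → 0+`. -/
def MemLip (r : ℕ) (α c : ℝ) (p : ℝ≥0∞) (f : ℝ → ℂ) : Prop :=
  MemX c p f ∧ ∃ C : ℝ, ∀ᶠ δ in 𝓝[>] (0 : ℝ), modulus r c p f δ ≤ ENNReal.ofReal (C * δ ^ α)

/-- The Mellin translation `(τ_h^c f)(x) = h^c f(h x)`. -/
def mellinTranslate (c h : ℝ) (f : ℝ → ℂ) (x : ℝ) : ℂ :=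
  ((h ^ c : ℝ) : ℂ) * f (h * x)

/-- The Mellin derivative: the limit as `h → 1` of `((τ_h^c f)(x) - f(x)) / (h - 1)`, that is, the
derivative of `h ↦ (τ_h^c f)(x)` at `h = 1`. -/
def mellinDeriv (c : ℝ) (f : ℝ → ℂ) (x : ℝ) : ℂ :=
  deriv (fun h : ℝ => mellinTranslate c h f x) 1

/-- The Mellin-Sobolev space `W^{r,p}_c` (for `r ≥ 1`). The `r`-th Mellin derivative of `g` exists
almost everywhere, since the derivative of `g` of order `r - 1` is locally absolutely
continuous. -/
def MemW (r : ℕ) (c : ℝ) (p : ℝ≥0∞) (f : ℝ → ℂ) : Prop :=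
  MemX c p f ∧ ∃ g : ℝ → ℂ,
    f =ᵐ[volume.restrict (Ioi 0)] g ∧
    ContDiffOn ℝ ((r - 1 : ℕ) : ℕ∞) g (Ioi 0) ∧
    (∀ a b : ℝ, 0 < a → a < b →
      AbsolutelyContinuousOnInterval (iteratedDerivWithin (r - 1) g (Ioi 0)) a b) ∧
    MemX c p ((mellinDeriv c)^[r] g)

/-- `lin_c(x) = x^{-c} sinc(log x)` for `x > 0`, where `sinc t = sin (π t) / (π t)`, `sinc 0 = 1`
(Mathlib's `Real.sinc` is `sin t / t`). -/
def lin (c x : ℝ) : ℝ :=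
  x ^ (-c) * Real.sinc (Real.pi * Real.log x)

/-- The `k`-th term of the exponential sampling series. -/
def samplingTerm (c T : ℝ) (f : ℝ → ℂ) (x : ℝ) (k : ℤ) : ℂ :=
  f (Real.exp (k / T)) * (lin (c / T) (Real.exp (-k) * x ^ T) : ℂ)

/-- The remainder `R_{πT} f` of the approximate exponential sampling formula. -/
def samplingRemainder (c T : ℝ) (f : ℝ → ℂ) (x : ℝ) : ℂ :=
  f x - ∑' k : ℤ, samplingTerm c T f x k

/-- For every `T > 0` and `x > 0` the exponential sampling series of `f` converges (so that the
remainder is meaningful), and the `X^∞_c` norm of the remainder is `O(T^γ)` as `T → ∞`. -/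
def SamplingRate (c γ : ℝ) (f : ℝ → ℂ) : Prop :=
  (∀ T : ℝ, 0 < T → ∀ x : ℝ, 0 < x → Summable (samplingTerm c T f x)) ∧
  ∃ C : ℝ, ∀ᶠ T : ℝ in atTop,
    normXInfty c (samplingRemainder c T f) ≤ ENNReal.ofReal (C * T ^ γ)

end

end MellinSampling

open MellinSampling

open scoped fwdDiff FourierTransform

/-! The substitution `x = e^s` moves the problem to the line. For `F = expPullback c f`, the `X^p_c`
norm becomes the `L^p` norm, Mellin differences become ordinary differences with step `log h`, the
Mellin derivative becomes `d/ds`, and the sampling series becomes the cardinal series of `F` with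
nodes `k/T`.

Let `G` be the Fourier transform of `F`. When `G` is integrable and the cardinal series converges,
the error is at most `2 ∫_{|v| ≥ T/2} |G|` (`norm_sub_tsum_sinc_le`). Indeed the sinc weights are
the Fourier coefficients of the 1-periodic extension of `v ↦ e^{2πi(Ts)v}` from `[-1/2, 1/2)`. The
series therefore arises from `∫ G(v) e^{2πisv} dv` on replacing the exponential by a `T`-periodic
function that agrees with it for `|v| < T/2`.

Smoothness of `F` makes this tail small. The symbol `e^{2πihv} - 1` of the difference operator has
modulus at least 1 when `1/4 ≤ |hv| ≤ 1/2`, so differences with step `h = 1/(4R)` control `G` on `R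
≤ |v| < 2R`. For `p = 2`, Plancherel bounds the `L²` norm of `G` there by `O(R^{-β})`; for `p = 1`,
`G` is pointwise `O(R^{-α})`, so its `L²` norm there is `O(R^{-(α-1/2)})`. Both are instances of
`HasAnnularDecay`, and summation over dyadic annuli (`lintegral_tail_le`) gives the rates `-β + 1/2`
and `-α + 1`. The same decay makes the samples square summable (`summable_sq_norm_sample`); since
the sinc weights are too, the series converges absolutely.

A Sobolev function of order `r` has `r`-th differences of size `O(h^r)`, so it is treated like a
Lipschitz function with exponent `r`. -/

/-! ### Passage from the half-line to the line -/

/-- The function `s ↦ e ^ (c s) f(e ^ s)` on the line corresponding to `f` on the half-line. -/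
noncomputable def expPullback (c : ℝ) (f : ℝ → ℂ) (s : ℝ) : ℂ :=
  (Real.exp (c * s) : ℂ) * f (Real.exp s)

lemma continuous_expPullback {c : ℝ} {f : ℝ → ℂ} (hf : ContinuousOn f (Ioi 0)) :
    Continuous (expPullback c f) := by
  unfold expPullback
  refine (by fun_prop : Continuous fun s : ℝ => (Real.exp (c * s) : ℂ)).mul ?_
  exact hf.comp_continuous Real.continuous_exp fun s => Real.exp_pos s

lemma lintegral_Ioi_eq_lintegral_exp (g : ℝ → ℝ≥0∞) :
    ∫⁻ x in Ioi 0, g x = ∫⁻ s, ENNReal.ofReal (Real.exp s) * g (Real.exp s) := by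
  have h := lintegral_image_eq_lintegral_abs_deriv_mul (s := univ) (f := Real.exp)
    (f' := Real.exp) MeasurableSet.univ
    (fun x _ => (Real.hasDerivAt_exp x).hasDerivWithinAt) Real.exp_injective.injOn g
  rw [image_univ, Real.range_exp] at h
  rw [h, Measure.restrict_univ]
  simp [abs_of_pos, Real.exp_pos]

/-- The Jacobian `e^s` of `x = e^s` cancels the `-1/p` in the weight exponent. -/
lemma normX_eq_eLpNorm (c : ℝ) {p : ℝ≥0∞} (hp0 : p ≠ 0) (hp : p ≠ ∞) (f : ℝ → ℂ) :
    normX c p f = eLpNorm (expPullback c f) p volume := by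
  have hpos : 0 < p.toReal := ENNReal.toReal_pos hp0 hp
  rw [normX, eLpNorm_eq_lintegral_rpow_enorm_toReal hp0 hp,
    eLpNorm_eq_lintegral_rpow_enorm_toReal hp0 hp, lintegral_Ioi_eq_lintegral_exp]
  congr 2
  ext s
  have h1 : ENNReal.ofReal (Real.exp s) = (ENNReal.ofReal (Real.exp (s / p.toReal))) ^ p.toReal := by
    rw [ENNReal.ofReal_rpow_of_pos (Real.exp_pos _), ← Real.exp_mul]
    congr 2
    field_simp
  rw [h1, ← ENNReal.mul_rpow_of_nonneg _ _ hpos.le]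
  congr 1
  have h2 (x : ℝ) : ‖(Real.exp x : ℂ)‖ₑ = ENNReal.ofReal (Real.exp x) := by
    rw [← ofReal_norm, Complex.norm_real, Real.norm_of_nonneg (Real.exp_pos x).le]
  rw [expPullback, enorm_mul, enorm_mul, ← mul_assoc, ← Real.exp_mul, h2, h2,
    ← ENNReal.ofReal_mul (Real.exp_pos _).le, ← Real.exp_add]
  congr 3
  field_simp
  ring

lemma expPullback_mellinDiff (r : ℕ) (c : ℝ) {h : ℝ} (hh : 0 < h) (f : ℝ → ℂ) :
    expPullback c (mellinDiff r c h f) = (Δ_[Real.log h])^[r] (expPullback c f) := by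
  ext s
  rw [fwdDiff_iter_eq_sum_shift, expPullback, mellinDiff, Finset.mul_sum]
  refine Finset.sum_congr rfl fun j _ => ?_
  have h1 : Real.exp (s + j • Real.log h) = h ^ j * Real.exp s := by
    rw [Real.exp_add, nsmul_eq_mul, ← Real.log_pow, Real.exp_log (by positivity), mul_comm]
  have h2 : Real.exp (c * (s + j • Real.log h)) = Real.exp (c * s) * h ^ ((j : ℝ) * c) := by
    rw [Real.rpow_def_of_pos hh, ← Real.exp_add, nsmul_eq_mul]
    congr 1
    ring
  rw [expPullback, h1, h2, zsmul_eq_mul]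
  push_cast
  ring

lemma memLp_expPullback {c : ℝ} {p : ℝ≥0∞} (hp0 : p ≠ 0) (hp : p ≠ ∞) {f : ℝ → ℂ}
    (hc : ContinuousOn f (Ioi 0)) (hf : MemX c p f) : MemLp (expPullback c f) p volume := by
  refine ⟨(continuous_expPullback hc).aestronglyMeasurable, ?_⟩
  rw [← normX_eq_eLpNorm c hp0 hp]
  exact hf.2

lemma MellinSampling.MemLip.exists_eLpNorm_fwdDiff_le {r : ℕ} {α c : ℝ} {p : ℝ≥0∞} (hp0 : p ≠ 0)
    (hp : p ≠ ∞) {f : ℝ → ℂ} (hf : MemLip r α c p f) :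
    ∃ C : ℝ, 0 ≤ C ∧ ∃ δ > 0, ∀ h : ℝ, 0 < h → h ≤ δ →
      eLpNorm ((Δ_[h])^[r] (expPullback c f)) p volume ≤ ENNReal.ofReal (C * h ^ α) := by
  obtain ⟨-, C, hC⟩ := hf
  obtain ⟨ε, hε, hC⟩ := mem_nhdsGT_iff_exists_Ioc_subset.1 hC
  refine ⟨max C 0, le_max_right _ _, ε, hε, fun h hh hhε => ?_⟩
  have h1 : modulus r c p f h ≤ ENNReal.ofReal (C * h ^ α) := hC ⟨hh, hhε⟩
  -- The dilation `e^h` is admissible in the modulus at `δ = h`, so one step size at a time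
  -- suffices.
  have h2 : normX c p (mellinDiff r c (Real.exp h) f) ≤ modulus r c p f h := by
    refine le_iSup₂_of_le (Real.exp h) ⟨Real.exp_pos h, ?_⟩ le_rfl
    rw [Real.log_exp, abs_of_pos hh]
  rw [normX_eq_eLpNorm c hp0 hp, expPullback_mellinDiff r c (Real.exp_pos h), Real.log_exp] at h2
  refine (h2.trans h1).trans (ENNReal.ofReal_le_ofReal ?_)
  gcongr
  exact le_max_left _ _

/-- The power `-c/T` in `lin` is what converts the weight `e^{cs}` at the evaluation point into the
weight `e^{ck/T}` at the node. -/
lemma exp_mul_samplingTerm (c : ℝ) {T : ℝ} (hT : 0 < T) (f : ℝ → ℂ) (s : ℝ) (k : ℤ) :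
    (Real.exp (c * s) : ℂ) * samplingTerm c T f (Real.exp s) k =
      expPullback c f (k / T) * (Real.sinc (Real.pi * (T * s - k)) : ℂ) := by
  have h1 : Real.exp (-k) * Real.exp s ^ T = Real.exp (T * s - k) := by
    rw [← Real.exp_mul, ← Real.exp_add]
    congr 1
    ring
  have h2 : Real.exp (c * s) * Real.exp (T * s - k) ^ (-(c / T)) = Real.exp (c * (k / T)) := by
    rw [← Real.exp_mul, ← Real.exp_add]
    congr 1
    field_simp
    ring
  rw [samplingTerm, lin, h1, Real.log_exp, expPullback, ← h2]
  push_cast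
  ring

lemma samplingRate_of_expPullback {c γ : ℝ} {f : ℝ → ℂ}
    (hs : ∀ T : ℝ, 0 < T → ∀ s : ℝ, Summable fun k : ℤ =>
      expPullback c f (k / T) * (Real.sinc (Real.pi * (T * s - k)) : ℂ))
    (hC : ∃ C : ℝ, ∀ᶠ T : ℝ in atTop, ∀ s : ℝ,
      ‖expPullback c f s - ∑' k : ℤ,
        expPullback c f (k / T) * (Real.sinc (Real.pi * (T * s - k)) : ℂ)‖ ≤ C * T ^ γ) :
    SamplingRate c γ f := by
  refine ⟨fun T hT x hx => ?_, ?_⟩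
  · have h := hs T hT (Real.log x)
    simp_rw [← exp_mul_samplingTerm c hT, Real.exp_log hx] at h
    refine (summable_mul_left_iff ?_).1 h
    exact_mod_cast (Real.exp_pos _).ne'
  · obtain ⟨C, hC⟩ := hC
    refine ⟨C, ?_⟩
    filter_upwards [hC, eventually_gt_atTop 0] with T h hT
    refine iSup₂_le fun x (hx : 0 < x) => ?_
    have h1 := h (Real.log x)
    simp_rw [← exp_mul_samplingTerm c hT, Real.exp_log hx, tsum_mul_left] at h1
    rw [expPullback, Real.exp_log hx, ← mul_sub, mul_comm c, Real.exp_mul, Real.exp_log hx] at h1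
    rw [← ofReal_norm]
    exact ENNReal.ofReal_le_ofReal h1

/-! ### Periodized exponentials and the error of the cardinal series -/

/-- The `1`-periodic extension of `v ↦ e ^ (2 π i σ v)`, `-1/2 ≤ v < 1/2`. -/
noncomputable def periodizedExp (σ : ℝ) : AddCircle (1 : ℝ) → ℂ :=
  AddCircle.liftIco 1 (-1 / 2) fun v : ℝ => Complex.exp (2 * Real.pi * Complex.I * (σ * v))

lemma norm_exp_two_pi_I_mul (x : ℝ) : ‖Complex.exp (2 * Real.pi * Complex.I * x)‖ = 1 := by
  rw [show (2 * Real.pi * Complex.I * x : ℂ) = ((2 * Real.pi * x : ℝ) : ℂ) * Complex.I by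
    push_cast; ring]
  exact Complex.norm_exp_ofReal_mul_I _

lemma norm_periodizedExp (σ : ℝ) (y : AddCircle (1 : ℝ)) : ‖periodizedExp σ y‖ = 1 := by
  rw [periodizedExp, AddCircle.liftIco, Function.comp_apply, Set.domRestrict_apply]
  exact_mod_cast norm_exp_two_pi_I_mul _

lemma periodizedExp_coe {σ v : ℝ} (hv : v ∈ Ico (-1 / 2 : ℝ) (1 / 2)) :
    periodizedExp σ v = Complex.exp (2 * Real.pi * Complex.I * (σ * v)) := by
  rw [periodizedExp, AddCircle.liftIco_coe_apply]
  norm_num at hv ⊢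
  exact hv

lemma measurable_periodizedExp (σ : ℝ) : Measurable (periodizedExp σ) := by
  have h : Measurable fun v : ℝ => Complex.exp (2 * Real.pi * Complex.I * (σ * v)) := by fun_prop
  exact (h.comp measurable_subtype_coe).comp (AddCircle.measurableEquivIco 1 (-1 / 2)).measurable

lemma continuousAt_periodizedExp (σ : ℝ) {y : AddCircle (1 : ℝ)} (hy : y ≠ (-1 / 2 : ℝ)) :
    ContinuousAt (periodizedExp σ) y := by
  have h : Continuous fun v : ℝ => Complex.exp (2 * Real.pi * Complex.I * (σ * v)) := by fun_prop
  exact (h.comp continuous_subtype_val).continuousAt.comp (AddCircle.continuousAt_equivIco 1 _ hy)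

lemma integral_exp_eq_sinc (a : ℝ) :
    ∫ v in (-1 / 2 : ℝ)..(1 / 2), Complex.exp (2 * Real.pi * Complex.I * a * v) =
      Real.sinc (Real.pi * a) := by
  rcases eq_or_ne a 0 with rfl | ha
  · norm_num
  · have hne : (2 * Real.pi * Complex.I * a : ℂ) ≠ 0 := by
      simp [ha, Real.pi_ne_zero]
    have hpi : (Real.pi : ℂ) ≠ 0 := by exact_mod_cast Real.pi_ne_zero
    have hac : (a : ℂ) ≠ 0 := by exact_mod_cast ha
    rw [integral_exp_mul_complex hne, Real.sinc_of_ne_zero (by positivity)]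
    push_cast
    have h1 : 2 * Real.pi * Complex.I * a * (1 / 2) = Real.pi * a * Complex.I := by ring
    have h2 : 2 * Real.pi * Complex.I * a * (-1 / 2) = -(Real.pi * a) * Complex.I := by ring
    rw [Complex.sin, h1, h2]
    field_simp
    rw [Complex.I_sq]
    ring

lemma fourierCoeffOn_exp (σ : ℝ) (k : ℤ) (hab : (-1 / 2 : ℝ) < -1 / 2 + 1) :
    fourierCoeffOn hab (fun v : ℝ => Complex.exp (2 * Real.pi * Complex.I * (σ * v))) k =
      Real.sinc (Real.pi * (σ - k)) := by
  rw [fourierCoeffOn_eq_integral, ← integral_exp_eq_sinc]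
  have h1 : (-1 / 2 + 1 : ℝ) = 1 / 2 := by norm_num
  have h2 : (1 / (1 / 2 - -1 / 2) : ℝ) = 1 := by norm_num
  rw [h1, h2, one_smul]
  refine intervalIntegral.integral_congr fun v _ => ?_
  rw [fourier_coe_apply, smul_eq_mul, ← Complex.exp_add]
  congr 1
  push_cast
  ring

lemma fourierCoeff_periodizedExp (σ : ℝ) (k : ℤ) :
    fourierCoeff (periodizedExp σ) k = Real.sinc (Real.pi * (σ - k)) := by
  rw [periodizedExp, fourierCoeff_liftIco_eq, fourierCoeffOn_exp]

/-- Parseval for an exponential on an interval of length 1, whose Fourier coefficients are these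
values. -/
lemma summable_sq_sinc (σ : ℝ) : Summable fun k : ℤ => Real.sinc (Real.pi * (σ - k)) ^ 2 := by
  have hab : (-1 / 2 : ℝ) < -1 / 2 + 1 := by norm_num
  have h := hasSum_sq_fourierCoeffOn (f := fun v : ℝ =>
    Complex.exp (2 * Real.pi * Complex.I * (σ * v))) hab ?_
  · simpa [fourierCoeffOn_exp] using h.summable
  · refine MemLp.of_bound (by fun_prop) 1 (ae_of_all _ fun v => ?_)
    exact_mod_cast (norm_exp_two_pi_I_mul (σ * v)).le

/-- The convolution of `G`, dilated by `T`, with `periodizedExp σ`. -/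
noncomputable def periodicConv (G : ℝ → ℂ) (T σ : ℝ) (y : AddCircle (1 : ℝ)) : ℂ :=
  ∫ v, G v * periodizedExp σ (y + ((v / T : ℝ) : AddCircle (1 : ℝ)))

lemma measurable_coe_div (T : ℝ) : Measurable fun v : ℝ => ((v / T : ℝ) : AddCircle (1 : ℝ)) :=
  (AddCircle.continuous_mk' 1).measurable.comp (by fun_prop)

/-- Dominated convergence: `periodizedExp` can jump only at the class of `-1/2`, which `y + v/T`
hits for countably many `v`. -/
lemma continuous_periodicConv {G : ℝ → ℂ} (hG : Integrable G) {T : ℝ} (hT : 0 < T) (σ : ℝ) :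
    Continuous (periodicConv G T σ) := by
  refine continuous_iff_continuousAt.2 fun y => ?_
  refine continuousAt_of_dominated (bound := fun v => ‖G v‖) ?_ ?_ hG.norm ?_
  · refine Eventually.of_forall fun y => hG.aestronglyMeasurable.mul ?_
    exact ((measurable_periodizedExp σ).comp
      ((measurable_coe_div T).const_add y)).aestronglyMeasurable
  · refine Eventually.of_forall fun y => ae_of_all _ fun v => ?_
    rw [norm_mul, norm_periodizedExp, mul_one]
  · induction y using QuotientAddGroup.induction_on with
    | H y =>
    have hcount : (range fun n : ℤ => T * (n - 1 / 2 - y)).Countable := countable_range _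
    filter_upwards [hcount.ae_notMem volume] with v hv
    refine continuousAt_const.mul ?_
    have hne : ((y : ℝ) : AddCircle (1 : ℝ)) + ((v / T : ℝ) : AddCircle (1 : ℝ)) ≠
        ((-1 / 2 : ℝ) : AddCircle (1 : ℝ)) := by
      intro h
      rw [← AddCircle.coe_add, ← sub_eq_zero, ← AddCircle.coe_sub,
        AddCircle.coe_eq_zero_iff] at h
      obtain ⟨n, hn⟩ := h
      refine hv ⟨n, ?_⟩
      simp only [zsmul_eq_mul, mul_one] at hn
      simp only [hn]
      field_simp
      ring
    exact ContinuousAt.comp (f := fun y => y + ((v / T : ℝ) : AddCircle (1 : ℝ)))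
      (continuousAt_periodizedExp σ hne) (by fun_prop)

/-- Fubini, then translation invariance of Haar measure: shifting by `v/T` multiplies the `k`-th
coefficient by `e^{2πikv/T}`, and integrating against `G` produces the sample at `k/T`. -/
lemma fourierCoeff_periodicConv {G : ℝ → ℂ} (hG : Integrable G) (T σ : ℝ) (k : ℤ) :
    fourierCoeff (periodicConv G T σ) k =
      (∫ v, G v * Complex.exp (2 * Real.pi * Complex.I * (k / T * v))) *
        Real.sinc (Real.pi * (σ - k)) := by
  rw [← fourierCoeff_periodizedExp]
  simp only [fourierCoeff, periodicConv, smul_eq_mul]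
  rw [← integral_mul_const]
  simp_rw [← integral_const_mul (μ := (volume : Measure ℝ))]
  rw [integral_integral_swap]
  · refine integral_congr_ae (ae_of_all _ fun v => ?_)
    simp only
    rw [← integral_add_right_eq_self (μ := AddCircle.haarAddCircle)
      (fun y : AddCircle (1 : ℝ) => fourier (-k) y * periodizedExp σ y) ((v / T : ℝ)),
      ← integral_const_mul]
    refine integral_congr_ae (ae_of_all _ fun y => ?_)
    have h1 : fourier (-k) (y + ((v / T : ℝ) : AddCircle (1 : ℝ))) *
        Complex.exp (2 * Real.pi * Complex.I * (k / T * v)) = fourier (-k) y := by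
      have h2 : Complex.exp (2 * Real.pi * Complex.I * (k / T * v)) =
          fourier k ((v / T : ℝ) : AddCircle (1 : ℝ)) := by
        rw [fourier_coe_apply]
        congr 1
        push_cast
        ring
      have h3 (w : AddCircle (1 : ℝ)) : (-k) • w + k • w = 0 := by rw [neg_smul, neg_add_cancel]
      rw [h2, fourier_apply, fourier_apply, fourier_apply, smul_add, AddCircle.toCircle_add,
        Circle.coe_mul, mul_assoc, ← Circle.coe_mul, ← AddCircle.toCircle_add, h3,
        AddCircle.toCircle_zero, Circle.coe_one, mul_one]
    simp only
    rw [← h1]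
    ring
  · have hint : Integrable (fun p : AddCircle (1 : ℝ) × ℝ => ‖G p.2‖)
        (AddCircle.haarAddCircle.prod volume) := by
      simpa using (integrable_const (1 : ℝ)).mul_prod hG.norm
    refine hint.mono ?_ (ae_of_all _ fun p => ?_)
    · refine AEStronglyMeasurable.mul ?_ (hG.aestronglyMeasurable.comp_snd.mul ?_)
      · exact ((fourier (-k)).continuous.comp continuous_fst).aestronglyMeasurable
      · exact ((measurable_periodizedExp σ).comp (measurable_fst.add
          ((measurable_coe_div T).comp measurable_snd))).aestronglyMeasurable
    · simp only [Function.uncurry, norm_mul, norm_periodizedExp, norm_norm, mul_one]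
      rw [fourier_apply, Circle.norm_coe, one_mul]

/-- The error of the sampling series of the inverse Fourier transform of an integrable function. -/
theorem norm_sub_tsum_sinc_le {G : ℝ → ℂ} (hG : Integrable G) {T : ℝ} (hT : 0 < T) (s : ℝ)
    (hs : Summable fun k : ℤ => (∫ v, G v * Complex.exp (2 * Real.pi * Complex.I * (k / T * v))) *
      (Real.sinc (Real.pi * (T * s - k)) : ℂ)) :
    ‖(∫ v, G v * Complex.exp (2 * Real.pi * Complex.I * (s * v))) -
      ∑' k : ℤ, (∫ v, G v * Complex.exp (2 * Real.pi * Complex.I * (k / T * v))) *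
        (Real.sinc (Real.pi * (T * s - k)) : ℂ)‖ ≤ 2 * ∫ v in {v | T / 2 ≤ |v|}, ‖G v‖ := by
  let H : C(AddCircle (1 : ℝ), ℂ) := ⟨periodicConv G T (T * s), continuous_periodicConv hG hT _⟩
  have hcoeff (k : ℤ) : fourierCoeff H k =
      (∫ v, G v * Complex.exp (2 * Real.pi * Complex.I * (k / T * v))) *
        (Real.sinc (Real.pi * (T * s - k)) : ℂ) := fourierCoeff_periodicConv hG T (T * s) k
  -- A continuous function with summable Fourier coefficients is the pointwise sum of its series; at
  -- `0` that series is the cardinal series.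
  have hsum := has_pointwise_sum_fourier_series_of_summable (f := H)
    (hs.congr fun k => (hcoeff k).symm) 0
  simp only [fourier_eval_zero, smul_eq_mul, mul_one, hcoeff] at hsum
  have hmeas : MeasurableSet {v : ℝ | T / 2 ≤ |v|} := measurableSet_le (by fun_prop) (by fun_prop)
  have hi1 : Integrable fun v => G v * Complex.exp (2 * Real.pi * Complex.I * (s * v)) := by
    refine hG.mono (hG.aestronglyMeasurable.mul (by fun_prop)) (ae_of_all _ fun v => ?_)
    rw [norm_mul, ← Complex.ofReal_mul, norm_exp_two_pi_I_mul, mul_one]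
  have hi2 : Integrable fun v => G v * periodizedExp (T * s)
      (0 + ((v / T : ℝ) : AddCircle (1 : ℝ))) := by
    refine hG.mono (hG.aestronglyMeasurable.mul ?_) (ae_of_all _ fun v => ?_)
    · exact ((measurable_periodizedExp _).comp
        ((measurable_coe_div T).const_add 0)).aestronglyMeasurable
    · rw [norm_mul, norm_periodizedExp, mul_one]
  rw [hsum.tsum_eq]
  change ‖_ - ∫ v, _‖ ≤ _
  rw [← integral_sub hi1 hi2, ← integral_const_mul, ← integral_indicator hmeas]
  refine norm_integral_le_of_norm_le ((hG.norm.const_mul 2).indicator hmeas)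
    (ae_of_all _ fun v => ?_)
  -- For `|v| < T/2` the point `v/T` lies in the fundamental interval and the two exponentials
  -- coincide; elsewhere both have modulus 1, which gives the factor 2.
  by_cases hv : T / 2 ≤ |v|
  · rw [indicator_of_mem (by exact hv)]
    refine (norm_sub_le _ _).trans ?_
    rw [norm_mul, norm_mul, norm_periodizedExp, ← Complex.ofReal_mul, norm_exp_two_pi_I_mul]
    linarith
  · rw [indicator_of_notMem (by exact hv)]
    push Not at hv
    rw [abs_lt] at hv
    have hmem : v / T ∈ Ico (-1 / 2 : ℝ) (1 / 2) := by
      constructor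
      · rw [le_div_iff₀ hT]; linarith
      · rw [div_lt_iff₀ hT]; linarith
    rw [zero_add, periodizedExp_coe hmem]
    have : ((T * s : ℝ) : ℂ) * ((v / T : ℝ) : ℂ) = s * v := by
      rw [← Complex.ofReal_mul, ← Complex.ofReal_mul]
      congr 1
      field_simp
    rw [this, sub_self, norm_zero]

/-! ### Annular decay and tail estimates -/

lemma lintegral_mul_le_sqrt_mul_sqrt {X : Type*} [MeasurableSpace X] {μ : Measure X}
    {g q : X → ℝ≥0∞} (hg : AEMeasurable g μ) (hq : AEMeasurable q μ) :
    ∫⁻ v, g v * q v ∂μ ≤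
      (∫⁻ v, g v ^ 2 ∂μ) ^ (1 / 2 : ℝ) * (∫⁻ v, q v ^ 2 ∂μ) ^ (1 / 2 : ℝ) := by
  simpa [ENNReal.rpow_two] using
    ENNReal.lintegral_mul_le_Lp_mul_Lq μ Real.HolderConjugate.two_two hg hq

/-- Cauchy–Schwarz on the annulus of radius `x = 2^j R` gives a multiple of `x^{-β} · x^{1/2}`, and
these sum geometrically because `β > 1/2`. The weight `q` allows both `q = 1` (integrability and the
rate) and `q` the modulus of a trigonometric polynomial (summability of samples). -/
lemma lintegral_tail_le {g q : ℝ → ℝ≥0∞} (hgm : AEMeasurable g) (hqm : AEMeasurable q)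
    {β C K R₀ : ℝ} (hβ : 1 / 2 < β) (hC : 0 ≤ C) (hK : 0 ≤ K) (hR₀ : 0 < R₀)
    (hg : ∀ R ≥ R₀, ∫⁻ v in {v | R ≤ |v| ∧ |v| < 2 * R}, g v ^ 2 ≤
      ENNReal.ofReal (C * R ^ (-2 * β)))
    (hq : ∀ R ≥ R₀, ∫⁻ v in {v | |v| ≤ R}, q v ^ 2 ≤ ENNReal.ofReal (K * R))
    {R : ℝ} (hR : R₀ ≤ R) :
    ∫⁻ v in {v | R ≤ |v|}, g v * q v ≤
      ENNReal.ofReal (√(2 * C * K) / (1 - 2 ^ (1 / 2 - β)) * R ^ (1 / 2 - β)) := by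
  have hRpos : 0 < R := hR₀.trans_le hR
  set ρ : ℝ := 2 ^ (1 / 2 - β) with hρ
  have hρ0 : 0 ≤ ρ := by positivity
  have hρ1 : ρ < 1 := Real.rpow_lt_one_of_one_lt_of_neg (by norm_num) (by linarith)
  let A : ℕ → Set ℝ := fun j => {v | 2 ^ j * R ≤ |v| ∧ |v| < 2 * (2 ^ j * R)}
  have hcover : {v : ℝ | R ≤ |v|} ⊆ ⋃ j, A j := by
    intro v (hv : R ≤ |v|)
    obtain ⟨n, hn1, hn2⟩ := exists_nat_pow_near (x := |v| / R) (y := 2)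
      ((one_le_div hRpos).2 hv) (by norm_num)
    rw [le_div_iff₀ hRpos] at hn1
    rw [div_lt_iff₀ hRpos, pow_succ] at hn2
    exact mem_iUnion.2 ⟨n, hn1, by linarith⟩
  have hA (j : ℕ) : ∫⁻ v in A j, g v * q v ≤
      ENNReal.ofReal (√(2 * C * K) * R ^ (1 / 2 - β) * ρ ^ j) := by
    set x : ℝ := 2 ^ j * R with hx
    have hx1 : R ≤ x := le_mul_of_one_le_left hRpos.le (one_le_pow₀ (by norm_num))
    have hx0 : 0 < x := hRpos.trans_le hx1
    have h1 := hg x (hR.trans hx1)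
    -- The annulus is enlarged to the ball of radius `2x`, whence the 2 in `√(2 * C * K)`.
    have h2 : ∫⁻ v in A j, q v ^ 2 ≤ ENNReal.ofReal (K * (2 * x)) := by
      refine (lintegral_mono_set fun v hv => ?_).trans (hq (2 * x) (by linarith))
      exact hv.2.le
    refine (lintegral_mul_le_sqrt_mul_sqrt hgm.restrict hqm.restrict).trans ?_
    calc _ ≤ ENNReal.ofReal (C * x ^ (-2 * β)) ^ (1 / 2 : ℝ) *
          ENNReal.ofReal (K * (2 * x)) ^ (1 / 2 : ℝ) := by gcongr
      _ = ENNReal.ofReal (√(2 * C * K) * R ^ (1 / 2 - β) * ρ ^ j) := by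
        rw [ENNReal.ofReal_rpow_of_nonneg (by positivity) (by norm_num),
          ENNReal.ofReal_rpow_of_nonneg (by positivity) (by norm_num),
          ← ENNReal.ofReal_mul (by positivity)]
        congr 1
        have h3 : x ^ (1 / 2 - β) = R ^ (1 / 2 - β) * ρ ^ j := by
          rw [hx, Real.mul_rpow (by positivity) hRpos.le, hρ, ← Real.rpow_natCast,
            ← Real.rpow_natCast, ← Real.rpow_mul (by norm_num), ← Real.rpow_mul (by norm_num)]
          ring_nf
        have h4 : x ^ (1 / 2 - β) = (x ^ (-2 * β)) ^ (1 / 2 : ℝ) * x ^ (1 / 2 : ℝ) := by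
          rw [← Real.rpow_mul hx0.le, ← Real.rpow_add hx0]
          ring_nf
        rw [mul_assoc, ← h3, h4, Real.sqrt_eq_rpow, Real.mul_rpow hC (by positivity),
          Real.mul_rpow hK (by positivity), Real.mul_rpow (by positivity) hx0.le,
          Real.mul_rpow (by positivity) hK, Real.mul_rpow (by positivity) hC]
        ring
  calc ∫⁻ v in {v | R ≤ |v|}, g v * q v ≤ ∫⁻ v in ⋃ j, A j, g v * q v := lintegral_mono_set hcover
    _ ≤ ∑' j, ∫⁻ v in A j, g v * q v := lintegral_iUnion_le _ _
    _ ≤ ∑' j, ENNReal.ofReal (√(2 * C * K) * R ^ (1 / 2 - β) * ρ ^ j) := ENNReal.tsum_le_tsum hA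
    _ = _ := by
      rw [← ENNReal.ofReal_tsum_of_nonneg (fun j => by positivity)
        ((summable_geometric_of_lt_one hρ0 hρ1).mul_left _), tsum_mul_left,
        tsum_geometric_of_lt_one hρ0 hρ1]
      congr 1
      ring

/-- `G` is locally square integrable and its `L²` norm over the annulus `R ≤ |v| < 2 R` is
`O(R ^ (-β))`. -/
structure HasAnnularDecay (G : ℝ → ℂ) (β : ℝ) : Prop where
  aestronglyMeasurable : AEStronglyMeasurable G
  lintegral_lt_top : ∀ R : ℝ, ∫⁻ v in {v | |v| ≤ R}, ‖G v‖ₑ ^ 2 < ∞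
  exists_le : ∃ C R₀ : ℝ, 0 ≤ C ∧ 0 < R₀ ∧ ∀ R ≥ R₀,
    ∫⁻ v in {v | R ≤ |v| ∧ |v| < 2 * R}, ‖G v‖ₑ ^ 2 ≤ ENNReal.ofReal (C * R ^ (-2 * β))

lemma volume_abs_le (R : ℝ) : volume {v : ℝ | |v| ≤ R} = ENNReal.ofReal (2 * R) := by
  have : {v : ℝ | |v| ≤ R} = Icc (-R) R := by ext v; simp [abs_le]
  rw [this, Real.volume_Icc]
  ring_nf

lemma lintegral_le_add_tail (g : ℝ → ℝ≥0∞) (R : ℝ) :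
    ∫⁻ v, g v ≤ (∫⁻ v in {v | |v| ≤ R}, g v) + ∫⁻ v in {v | R ≤ |v|}, g v := by
  rw [← setLIntegral_univ]
  refine (lintegral_mono_set fun v _ => ?_).trans (lintegral_union_le _ _ _)
  exact le_total |v| R

namespace HasAnnularDecay

variable {G : ℝ → ℂ} {β : ℝ}

lemma exists_tail_le (hG : HasAnnularDecay G β) (hβ : 1 / 2 < β) :
    ∃ C R₀ : ℝ, 0 ≤ C ∧ 0 < R₀ ∧ ∀ R ≥ R₀,
      ∫⁻ v in {v | R ≤ |v|}, ‖G v‖ₑ ≤ ENNReal.ofReal (C * R ^ (1 / 2 - β)) := by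
  obtain ⟨C, R₀, hC, hR₀, h⟩ := hG.exists_le
  have hρ1 : (2 : ℝ) ^ (1 / 2 - β) < 1 :=
    Real.rpow_lt_one_of_one_lt_of_neg (by norm_num) (by linarith)
  -- The case `q = 1`, with `K = 2` since `|v| ≤ R` has length `2R`.
  refine ⟨√(2 * C * 2) / (1 - 2 ^ (1 / 2 - β)), R₀, div_nonneg (by positivity) (by linarith), hR₀,
    fun R hR => ?_⟩
  simpa using lintegral_tail_le hG.aestronglyMeasurable.enorm
    (aemeasurable_const (b := (1 : ℝ≥0∞))) hβ hC
    (by norm_num : (0 : ℝ) ≤ 2) hR₀ h (fun R _ => by simp [volume_abs_le]) hR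

lemma lintegral_mul_le (hG : HasAnnularDecay G β) {q : ℝ → ℝ≥0∞} (hq : AEMeasurable q) (R : ℝ) :
    ∫⁻ v in {v | |v| ≤ R}, ‖G v‖ₑ * q v ≤
      (∫⁻ v in {v | |v| ≤ R}, ‖G v‖ₑ ^ 2) ^ (1 / 2 : ℝ) *
        (∫⁻ v in {v | |v| ≤ R}, q v ^ 2) ^ (1 / 2 : ℝ) :=
  lintegral_mul_le_sqrt_mul_sqrt hG.aestronglyMeasurable.enorm.restrict hq.restrict

lemma integrable (hG : HasAnnularDecay G β) (hβ : 1 / 2 < β) : Integrable G := by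
  refine ⟨hG.aestronglyMeasurable, ?_⟩
  obtain ⟨C, R₀, hC, hR₀, h⟩ := hG.exists_tail_le hβ
  refine (lintegral_le_add_tail _ R₀).trans_lt (ENNReal.add_lt_top.2 ⟨?_, ?_⟩)
  · have h1 := hG.lintegral_mul_le (aemeasurable_const (b := (1 : ℝ≥0∞))) R₀
    simp only [mul_one, one_pow, lintegral_const, Measure.restrict_apply MeasurableSet.univ,
      univ_inter, volume_abs_le, one_mul] at h1
    refine h1.trans_lt (ENNReal.mul_lt_top ?_ ?_)
    · exact ENNReal.rpow_lt_top_of_nonneg (by norm_num) (hG.lintegral_lt_top R₀).ne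
    · exact ENNReal.rpow_lt_top_of_nonneg (by norm_num) ENNReal.ofReal_ne_top
  · exact (h R₀ le_rfl).trans_lt ENNReal.ofReal_lt_top

end HasAnnularDecay

/-! ### Trigonometric polynomials and square summability of the samples -/

/-- The trigonometric polynomial with coefficients `a` and period `T`. -/
noncomputable def trigPoly (T : ℝ) (S : Finset ℤ) (a : ℤ → ℂ) (v : ℝ) : ℂ :=
  ∑ k ∈ S, a k * Complex.exp (2 * Real.pi * Complex.I * (k / T * v))

lemma continuous_trigPoly (T : ℝ) (S : Finset ℤ) (a : ℤ → ℂ) : Continuous (trigPoly T S a) := by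
  unfold trigPoly
  fun_prop

/-- The interval has length `2NT`, a whole number of periods, so distinct frequencies are
orthogonal. -/
lemma integral_exp_mul_conj_exp {T : ℝ} (hT : 0 < T) (N : ℕ) (k l : ℤ) :
    ∫ v in (-(N * T))..(N * T), Complex.exp (2 * Real.pi * Complex.I * (k / T * v)) *
      (starRingEnd ℂ) (Complex.exp (2 * Real.pi * Complex.I * (l / T * v))) =
      if k = l then (2 * N * T : ℂ) else 0 := by
  have hTc : (T : ℂ) ≠ 0 := by exact_mod_cast hT.ne'
  have h1 (v : ℝ) : Complex.exp (2 * Real.pi * Complex.I * (k / T * v)) *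
      (starRingEnd ℂ) (Complex.exp (2 * Real.pi * Complex.I * (l / T * v))) =
      Complex.exp (2 * Real.pi * Complex.I * ((k - l) / T) * v) := by
    rw [← Complex.exp_conj, ← Complex.exp_add]
    congr 1
    simp only [map_mul, map_div₀, Complex.conj_ofReal, Complex.conj_I, map_intCast,
      map_ofNat (starRingEnd ℂ) 2]
    ring
  simp_rw [h1]
  split_ifs with hkl
  · simp [hkl]
    ring
  · have hkl' : (k - l : ℂ) ≠ 0 := by
      rw [sub_ne_zero]
      exact_mod_cast hkl
    rw [integral_exp_mul_complex (by
      refine mul_ne_zero Complex.two_pi_I_ne_zero (div_ne_zero hkl' hTc))]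
    have h2 : Complex.exp (2 * Real.pi * Complex.I * ((k - l) / T) * ((N * T : ℝ) : ℂ)) = 1 := by
      rw [Complex.exp_eq_one_iff]
      refine ⟨(k - l) * N, ?_⟩
      push_cast
      field_simp
    have h3 : Complex.exp (2 * Real.pi * Complex.I * ((k - l) / T) * ((-(N * T) : ℝ) : ℂ)) = 1 := by
      rw [Complex.exp_eq_one_iff]
      refine ⟨-((k - l) * N), ?_⟩
      push_cast
      field_simp
    rw [h2, h3, sub_self, zero_div]

lemma integral_norm_sq_trigPoly {T : ℝ} (hT : 0 < T) (N : ℕ) (S : Finset ℤ) (a : ℤ → ℂ) :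
    ∫ v in (-(N * T))..(N * T), ‖trigPoly T S a v‖ ^ 2 = 2 * N * T * ∑ k ∈ S, ‖a k‖ ^ 2 := by
  have h : (∫ v in (-(N * T))..(N * T), ((‖trigPoly T S a v‖ ^ 2 : ℝ) : ℂ)) =
      ((2 * N * T * ∑ k ∈ S, ‖a k‖ ^ 2 : ℝ) : ℂ) := by
    have h1 (v : ℝ) : ((‖trigPoly T S a v‖ ^ 2 : ℝ) : ℂ) = ∑ k ∈ S, ∑ l ∈ S,
        a k * (starRingEnd ℂ) (a l) * (Complex.exp (2 * Real.pi * Complex.I * (k / T * v)) *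
          (starRingEnd ℂ) (Complex.exp (2 * Real.pi * Complex.I * (l / T * v)))) := by
      rw [Complex.ofReal_pow, ← Complex.mul_conj', trigPoly, map_sum, Finset.sum_mul_sum]
      refine Finset.sum_congr rfl fun k _ => Finset.sum_congr rfl fun l _ => ?_
      rw [map_mul]
      ring
    have hcont (k l : ℤ) : Continuous fun v : ℝ => a k * (starRingEnd ℂ) (a l) *
        (Complex.exp (2 * Real.pi * Complex.I * (k / T * v)) *
          (starRingEnd ℂ) (Complex.exp (2 * Real.pi * Complex.I * (l / T * v)))) := by
      refine continuous_const.mul (Continuous.mul (by fun_prop) ?_)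
      exact Complex.continuous_conj.comp (by fun_prop)
    simp_rw [h1]
    rw [intervalIntegral.integral_finsetSum fun k _ =>
      (continuous_finsetSum S fun l _ => hcont k l).intervalIntegrable _ _]
    push_cast
    rw [Finset.mul_sum]
    refine Finset.sum_congr rfl fun k hk => ?_
    rw [intervalIntegral.integral_finsetSum fun l _ => (hcont k l).intervalIntegrable _ _]
    simp_rw [intervalIntegral.integral_const_mul, integral_exp_mul_conj_exp hT]
    simp only [mul_ite, mul_zero, Finset.sum_ite_eq, hk, if_true]
    rw [Complex.mul_conj']
    ring
  rw [intervalIntegral.integral_ofReal] at h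
  exact_mod_cast h

/-- Enlarge `[-R, R]` to `[-NT, NT]` and use orthogonality there. Since `R ≥ T`, rounding up to a
multiple of `T` at most doubles `R`, which gives the constant 4. -/
lemma lintegral_sq_trigPoly_le {T R : ℝ} (hT : 0 < T) (hR : T ≤ R) (S : Finset ℤ) (a : ℤ → ℂ) :
    ∫⁻ v in {v | |v| ≤ R}, ‖trigPoly T S a v‖ₑ ^ 2 ≤
      ENNReal.ofReal (4 * (∑ k ∈ S, ‖a k‖ ^ 2) * R) := by
  set N := ⌈R / T⌉₊ with hN
  have hE : 0 ≤ ∑ k ∈ S, ‖a k‖ ^ 2 := Finset.sum_nonneg fun k _ => by positivity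
  have h1 : R ≤ N * T := by
    rw [← div_le_iff₀ hT]
    exact Nat.le_ceil _
  have h2 : N * T ≤ 2 * R := by
    have h3 : (N : ℝ) < R / T + 1 := Nat.ceil_lt_add_one (div_nonneg (hT.le.trans hR) hT.le)
    have h4 : (N : ℝ) * T ≤ (R / T + 1) * T := by gcongr
    rw [add_mul, div_mul_cancel₀ _ hT.ne'] at h4
    linarith
  have hNT : -(N * T) ≤ N * T := by linarith
  calc ∫⁻ v in {v | |v| ≤ R}, ‖trigPoly T S a v‖ₑ ^ 2
      ≤ ∫⁻ v in Ioc (-(N * T)) (N * T), ‖trigPoly T S a v‖ₑ ^ 2 := by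
        rw [Measure.restrict_congr_set Ioc_ae_eq_Icc]
        refine lintegral_mono_set fun v (hv : |v| ≤ R) => ?_
        exact abs_le.1 (hv.trans h1)
    _ = ENNReal.ofReal (∫ v in Ioc (-(N * T)) (N * T), ‖trigPoly T S a v‖ ^ 2) := by
        rw [ofReal_integral_eq_lintegral_ofReal]
        · refine lintegral_congr fun v => ?_
          rw [ENNReal.ofReal_pow (norm_nonneg _), ofReal_norm]
        · exact (((continuous_trigPoly T S a).norm.pow 2).integrableOn_Icc).mono_set
            Ioc_subset_Icc_self
        · exact ae_of_all _ fun v => by positivity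
    _ ≤ _ := by
        rw [← intervalIntegral.integral_of_le hNT, integral_norm_sq_trigPoly hT]
        refine ENNReal.ofReal_le_ofReal ?_
        nlinarith

namespace HasAnnularDecay

variable {G : ℝ → ℂ} {β : ℝ}

/-- Pairing with `G` is bounded on trigonometric polynomials in the `ℓ²` norm of the coefficients,
with `B` independent of `S` and `a`. Cauchy–Schwarz handles a ball of radius at least `T`, and
`lintegral_tail_le` with `K = 4E` the rest. -/
lemma exists_lintegral_mul_trigPoly_le (hG : HasAnnularDecay G β) (hβ : 1 / 2 < β) {T : ℝ}
    (hT : 0 < T) : ∃ B : ℝ, 0 ≤ B ∧ ∀ (S : Finset ℤ) (a : ℤ → ℂ),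
      ∫⁻ v, ‖G v‖ₑ * ‖trigPoly T S a v‖ₑ ≤ ENNReal.ofReal (B * √(∑ k ∈ S, ‖a k‖ ^ 2)) := by
  obtain ⟨C, R₀, hC, hR₀, h⟩ := hG.exists_le
  have hρ1 : (2 : ℝ) ^ (1 / 2 - β) < 1 :=
    Real.rpow_lt_one_of_one_lt_of_neg (by norm_num) (by linarith)
  have hρ1' : 0 < 1 - (2 : ℝ) ^ (1 / 2 - β) := by linarith
  set R := max R₀ T
  have hRpos : 0 < R := hR₀.trans_le (le_max_left _ _)
  set I := (∫⁻ v in {v | |v| ≤ R}, ‖G v‖ₑ ^ 2).toReal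
  have hI : ∫⁻ v in {v | |v| ≤ R}, ‖G v‖ₑ ^ 2 = ENNReal.ofReal I :=
    (ENNReal.ofReal_toReal (hG.lintegral_lt_top R).ne).symm
  have hI0 : 0 ≤ I := ENNReal.toReal_nonneg
  refine ⟨√I * √(4 * R) + √(2 * C * 4) / (1 - 2 ^ (1 / 2 - β)) * R ^ (1 / 2 - β), by positivity,
    fun S a => ?_⟩
  set E := ∑ k ∈ S, ‖a k‖ ^ 2
  have hE : 0 ≤ E := Finset.sum_nonneg fun k _ => by positivity
  have hm : AEMeasurable fun v => ‖trigPoly T S a v‖ₑ :=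
    (continuous_trigPoly T S a).aestronglyMeasurable.enorm
  have h1 : ∫⁻ v in {v | |v| ≤ R}, ‖G v‖ₑ * ‖trigPoly T S a v‖ₑ ≤
      ENNReal.ofReal (√I * √(4 * R) * √E) := by
    refine (hG.lintegral_mul_le hm R).trans ?_
    rw [hI]
    calc _ ≤ ENNReal.ofReal I ^ (1 / 2 : ℝ) * ENNReal.ofReal (4 * E * R) ^ (1 / 2 : ℝ) := by
          gcongr
          exact lintegral_sq_trigPoly_le hT (le_max_right _ _) S a
      _ = _ := by
          rw [ENNReal.ofReal_rpow_of_nonneg hI0 (by norm_num),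
            ENNReal.ofReal_rpow_of_nonneg (by positivity) (by norm_num),
            ← ENNReal.ofReal_mul (by positivity), ← Real.sqrt_eq_rpow, ← Real.sqrt_eq_rpow,
            mul_right_comm 4 E R, mul_assoc (√I), ← Real.sqrt_mul (by positivity : 0 ≤ 4 * R)]
  have h2 : ∫⁻ v in {v | R ≤ |v|}, ‖G v‖ₑ * ‖trigPoly T S a v‖ₑ ≤
      ENNReal.ofReal (√(2 * C * 4) / (1 - 2 ^ (1 / 2 - β)) * R ^ (1 / 2 - β) * √E) := by
    refine (lintegral_tail_le (R₀ := R) hG.aestronglyMeasurable.enorm hm hβ hC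
      (by positivity : 0 ≤ 4 * E) hRpos (fun x hx => h x ((le_max_left _ _).trans hx))
      (fun x hx => lintegral_sq_trigPoly_le hT ((le_max_right _ _).trans hx) S a) le_rfl).trans ?_
    refine ENNReal.ofReal_le_ofReal (le_of_eq ?_)
    rw [← mul_assoc, Real.sqrt_mul (by positivity) E]
    ring
  refine (lintegral_le_add_tail _ R).trans ((add_le_add h1 h2).trans ?_)
  rw [← ENNReal.ofReal_add (by positivity) (by positivity), ← add_mul]

/-- Duality: with the conjugated samples as coefficients, the pairing of `G` with the polynomial
equals the partial sum `E` itself. Hence `E ≤ B√E`, so `E ≤ B²` for every finite set of nodes. -/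
lemma summable_sq_norm_sample (hG : HasAnnularDecay G β) (hβ : 1 / 2 < β) {T : ℝ} (hT : 0 < T) :
    Summable fun k : ℤ =>
      ‖∫ v, G v * Complex.exp (2 * Real.pi * Complex.I * (k / T * v))‖ ^ 2 := by
  obtain ⟨B, hB, h⟩ := hG.exists_lintegral_mul_trigPoly_le hβ hT
  set F : ℤ → ℂ := fun k => ∫ v, G v * Complex.exp (2 * Real.pi * Complex.I * (k / T * v))
  refine summable_of_sum_le (c := B ^ 2) (fun k => by positivity) fun S => ?_
  set E := ∑ k ∈ S, ‖F k‖ ^ 2 with hE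
  have hE0 : 0 ≤ E := Finset.sum_nonneg fun k _ => by positivity
  have hint (k : ℤ) :
      Integrable fun v => G v * Complex.exp (2 * Real.pi * Complex.I * (k / T * v)) := by
    have hGi := hG.integrable hβ
    refine hGi.mono (hGi.aestronglyMeasurable.mul (by fun_prop)) (ae_of_all _ fun v => ?_)
    rw [norm_mul]
    have := norm_exp_two_pi_I_mul (k / T * v)
    push_cast at this
    rw [this, mul_one]
  have h1 : (E : ℂ) = ∫ v, G v * trigPoly T S (fun k => (starRingEnd ℂ) (F k)) v := by
    simp_rw [trigPoly, Finset.mul_sum, mul_left_comm (G _)]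
    rw [integral_finsetSum _ fun k _ => (hint k).const_mul _]
    simp_rw [integral_const_mul]
    rw [hE]
    push_cast
    exact Finset.sum_congr rfl fun k _ => (Complex.conj_mul' _).symm
  have h2 : E ≤ B * √E := by
    have h3 := h S fun k => (starRingEnd ℂ) (F k)
    simp_rw [RCLike.norm_conj, ← enorm_mul] at h3
    have h4 := (enorm_integral_le_lintegral_enorm _).trans h3
    rw [← h1, ← ofReal_norm, Complex.norm_real, Real.norm_of_nonneg hE0] at h4
    exact (ENNReal.ofReal_le_ofReal_iff (by positivity)).1 h4
  have h5 : E = √E ^ 2 := (Real.sq_sqrt hE0).symm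
  rw [h5]
  rcases (Real.sqrt_nonneg E).eq_or_lt with h6 | h6
  · rw [← h6]
    nlinarith
  · have h7 : √E ≤ B := by
      refine le_of_mul_le_mul_right ?_ h6
      nlinarith
    gcongr

lemma summable_sample_mul_sinc (hG : HasAnnularDecay G β) (hβ : 1 / 2 < β) {T : ℝ} (hT : 0 < T)
    (s : ℝ) : Summable fun k : ℤ =>
      (∫ v, G v * Complex.exp (2 * Real.pi * Complex.I * (k / T * v))) *
        (Real.sinc (Real.pi * (T * s - k)) : ℂ) := by
  refine Summable.of_norm_bounded ((hG.summable_sq_norm_sample hβ hT).add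
    (summable_sq_sinc (T * s))) fun k => ?_
  rw [norm_mul, Complex.norm_real, ← sq_abs (Real.sinc _), ← Real.norm_eq_abs]
  nlinarith [sq_nonneg (‖∫ v, G v * Complex.exp (2 * Real.pi * Complex.I * (k / T * v))‖ -
    ‖Real.sinc (Real.pi * (T * s - k))‖), norm_nonneg (Real.sinc (Real.pi * (T * s - k))),
    norm_nonneg (∫ v, G v * Complex.exp (2 * Real.pi * Complex.I * (k / T * v)))]

lemma exists_norm_sub_tsum_sinc_le (hG : HasAnnularDecay G β) (hβ : 1 / 2 < β) :
    ∃ C : ℝ, ∀ᶠ T : ℝ in atTop, ∀ s : ℝ,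
      ‖(∫ v, G v * Complex.exp (2 * Real.pi * Complex.I * (s * v))) -
        ∑' k : ℤ, (∫ v, G v * Complex.exp (2 * Real.pi * Complex.I * (k / T * v))) *
          (Real.sinc (Real.pi * (T * s - k)) : ℂ)‖ ≤ C * T ^ (-β + 1 / 2) := by
  obtain ⟨C, R₀, hC, hR₀, h⟩ := hG.exists_tail_le hβ
  refine ⟨2 * (C * 2⁻¹ ^ (1 / 2 - β)), ?_⟩
  filter_upwards [eventually_ge_atTop (2 * R₀), eventually_gt_atTop 0] with T hT hT0 s
  refine (norm_sub_tsum_sinc_le (hG.integrable hβ) hT0 s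
    (hG.summable_sample_mul_sinc hβ hT0 s)).trans ?_
  rw [mul_assoc]
  gcongr
  have h1 := h (T / 2) (by linarith)
  rw [integral_norm_eq_lintegral_enorm hG.aestronglyMeasurable.restrict]
  refine ENNReal.toReal_le_of_le_ofReal (by positivity) (h1.trans (le_of_eq ?_))
  rw [div_eq_inv_mul, Real.mul_rpow (by norm_num) hT0.le]
  ring_nf

end HasAnnularDecay

lemma samplingRate_of_hasAnnularDecay {c β : ℝ} {f G : ℝ → ℂ} (hβ : 1 / 2 < β)
    (hG : HasAnnularDecay G β)
    (hf : ∀ s, expPullback c f s = ∫ v, G v * Complex.exp (2 * Real.pi * Complex.I * (s * v))) :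
    SamplingRate c (-β + 1 / 2) f := by
  have h1 (T : ℝ) (k : ℤ) : expPullback c f (k / T) =
      ∫ v, G v * Complex.exp (2 * Real.pi * Complex.I * (k / T * v)) := by
    rw [hf]
    push_cast
    rfl
  refine samplingRate_of_expPullback (fun T hT s => ?_) ?_
  · simp_rw [h1]
    exact hG.summable_sample_mul_sinc hβ hT s
  · simp_rw [h1, hf]
    exact hG.exists_norm_sub_tsum_sinc_le hβ

/-! ### The symbol of the difference operator -/

/-- The symbol `e ^ (2 π i h v) - 1` of the difference operator `Δ_[h]`. -/
noncomputable def diffSymbol (h v : ℝ) : ℂ := Complex.exp (2 * Real.pi * Complex.I * (h * v)) - 1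

lemma continuous_diffSymbol (h : ℝ) : Continuous (diffSymbol h) := by
  unfold diffSymbol
  fun_prop

lemma norm_diffSymbol_le (h v : ℝ) : ‖diffSymbol h v‖ ≤ 2 := by
  refine (norm_sub_le _ _).trans ?_
  rw [← Complex.ofReal_mul, norm_exp_two_pi_I_mul]
  norm_num

/-- The angle `2π|hv|` lies in `[π/2, π]`, where the cosine is nonpositive, so the real part of the
symbol is at most `-1`. -/
lemma one_le_norm_diffSymbol {h v : ℝ} (h1 : 1 / 4 ≤ |h * v|) (h2 : |h * v| ≤ 1 / 2) :
    1 ≤ ‖diffSymbol h v‖ := by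
  have hre : (diffSymbol h v).re ≤ -1 := by
    rw [diffSymbol, show (2 * Real.pi * Complex.I * (h * v) : ℂ) =
      ((2 * Real.pi * (h * v) : ℝ) : ℂ) * Complex.I by push_cast; ring, Complex.sub_re,
      Complex.exp_ofReal_mul_I_re, Complex.one_re, ← Real.cos_abs]
    have h3 : |2 * Real.pi * (h * v)| = 2 * Real.pi * |h * v| := by
      rw [abs_mul, abs_of_pos Real.two_pi_pos]
    have := Real.cos_nonpos_of_pi_div_two_le_of_le (x := |2 * Real.pi * (h * v)|)
      (by rw [h3]; nlinarith [Real.pi_pos]) (by rw [h3]; nlinarith [Real.pi_pos])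
    linarith
  have h4 := (neg_le_abs _).trans (Complex.abs_re_le_norm (diffSymbol h v))
  linarith

/-! ### Integrable functions -/

lemma fourier_comp_add_right (F : ℝ → ℂ) (h v : ℝ) :
    𝓕 (fun s => F (s + h)) v = Complex.exp (2 * Real.pi * Complex.I * (h * v)) * 𝓕 F v := by
  symm
  rw [Real.fourier_real_eq_integral_exp_smul, Real.fourier_real_eq_integral_exp_smul,
    ← integral_const_mul, ← integral_add_right_eq_self (μ := volume) _ h]
  refine integral_congr_ae (ae_of_all _ fun s => ?_)
  simp only [smul_eq_mul]
  rw [← mul_assoc, ← Complex.exp_add]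
  congr 2
  push_cast
  ring

lemma fourier_fwdDiff {F : ℝ → ℂ} (hF : Integrable F) (h v : ℝ) :
    𝓕 (Δ_[h] F) v = diffSymbol h v * 𝓕 F v := by
  have h1 : 𝓕 (Δ_[h] F) v = 𝓕 (fun s => F (s + h)) v - 𝓕 F v := by
    rw [Real.fourier_real_eq, Real.fourier_real_eq, Real.fourier_real_eq, ← integral_sub]
    · simp only [fwdDiff, smul_sub]
    · simpa [mul_comm] using (Real.fourierIntegral_convergent_iff v).2 (hF.comp_add_right h)
    · simpa [mul_comm] using (Real.fourierIntegral_convergent_iff v).2 hF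
  rw [h1, fourier_comp_add_right, diffSymbol, sub_mul, one_mul]

lemma integrable_fwdDiff {F : ℝ → ℂ} (hF : Integrable F) (h : ℝ) : Integrable (Δ_[h] F) :=
  (hF.comp_add_right h).sub hF

lemma integrable_fwdDiff_iter {F : ℝ → ℂ} (hF : Integrable F) (h : ℝ) (r : ℕ) :
    Integrable ((Δ_[h])^[r] F) := by
  induction r with
  | zero => exact hF
  | succ r ih => rw [Function.iterate_succ_apply']; exact integrable_fwdDiff ih h

lemma fourier_fwdDiff_iter {F : ℝ → ℂ} (hF : Integrable F) (h v : ℝ) (r : ℕ) :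
    𝓕 ((Δ_[h])^[r] F) v = diffSymbol h v ^ r * 𝓕 F v := by
  induction r with
  | zero => simp
  | succ r ih =>
    rw [Function.iterate_succ_apply', fourier_fwdDiff (integrable_fwdDiff_iter hF h r), ih,
      pow_succ']
    ring

lemma norm_fourier_le_of_eLpNorm_fwdDiff_le {F : ℝ → ℂ} (hF : Integrable F) {r : ℕ} {B h v : ℝ}
    (hB : 0 ≤ B) (hd : eLpNorm ((Δ_[h])^[r] F) 1 volume ≤ ENNReal.ofReal B)
    (h1 : 1 / 4 ≤ |h * v|) (h2 : |h * v| ≤ 1 / 2) : ‖𝓕 F v‖ ≤ B := by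
  have h3 : ‖𝓕 ((Δ_[h])^[r] F) v‖ ≤ B := by
    have h4 : ‖𝓕 ((Δ_[h])^[r] F) v‖ ≤ ∫ s, ‖((Δ_[h])^[r] F) s‖ :=
      VectorFourier.norm_fourierIntegral_le_integral_norm _ _ _ _ _
    refine h4.trans ?_
    rw [integral_norm_eq_lintegral_enorm (integrable_fwdDiff_iter hF h r).aestronglyMeasurable]
    rw [eLpNorm_one_eq_lintegral_enorm] at hd
    exact ENNReal.toReal_le_of_le_ofReal hB hd
  rw [fourier_fwdDiff_iter hF, norm_mul, norm_pow] at h3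
  refine le_trans ?_ h3
  exact le_mul_of_one_le_left (norm_nonneg _) (one_le_pow₀ (one_le_norm_diffSymbol h1 h2))

/-- For `h = 1 / (4 R)`, `R ≤ |v| < 2 R`, the product `h v` lies between `1 / 4` and `1 / 2`. -/
lemma abs_mul_mem_of_annulus {R v : ℝ} (hR : 0 < R) (h1 : R ≤ |v|) (h2 : |v| < 2 * R) :
    1 / 4 ≤ |1 / (4 * R) * v| ∧ |1 / (4 * R) * v| ≤ 1 / 2 := by
  rw [abs_mul, abs_of_pos (by positivity : 0 < 1 / (4 * R)), one_div_mul_eq_div,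
    le_div_iff₀ (by positivity), div_le_iff₀ (by positivity)]
  constructor <;> linarith

lemma volume_annulus_le (R : ℝ) :
    volume {v : ℝ | R ≤ |v| ∧ |v| < 2 * R} ≤ ENNReal.ofReal (4 * R) := by
  refine (measure_mono fun v hv => ?_).trans ((volume_abs_le (2 * R)).trans_le (le_of_eq ?_))
  · exact hv.2.le
  · ring_nf

/-- The transform is pointwise `O(R^{-α})` on an annulus of measure at most `4R`; passing to the
`L²` norm costs the exponent `1/2`. -/
lemma hasAnnularDecay_fourier {F : ℝ → ℂ} (hF : Integrable F) {r : ℕ} {α C δ : ℝ} (hC : 0 ≤ C)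
    (hδ : 0 < δ) (hd : ∀ h : ℝ, 0 < h → h ≤ δ →
      eLpNorm ((Δ_[h])^[r] F) 1 volume ≤ ENNReal.ofReal (C * h ^ α)) :
    HasAnnularDecay (𝓕 F) (α - 1 / 2) := by
  have hcont : Continuous (𝓕 F) :=
    VectorFourier.fourierIntegral_continuous Real.continuous_fourierChar (by fun_prop) hF
  -- The constant is that of `(C (1/(4R))^α)² · 4R`; the threshold `1/(4δ)` makes the step `1/(4R)`
  -- at most `δ`.
  refine ⟨hcont.aestronglyMeasurable, fun R => ?_, C ^ 2 * (4 ^ (-α)) ^ 2 * 4, 1 / (4 * δ),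
    by positivity, by positivity, fun R hR => ?_⟩
  · have hK : IsCompact {v : ℝ | |v| ≤ R} := by
      have : {v : ℝ | |v| ≤ R} = Icc (-R) R := by ext v; simp [abs_le]
      rw [this]
      exact isCompact_Icc
    have h1 := ((hcont.norm.pow 2).continuousOn.integrableOn_compact (μ := volume) hK).2
    refine lt_of_le_of_lt (lintegral_mono fun v => ?_) h1
    rw [Pi.pow_apply, enorm_pow, enorm_norm]
  · have hR0 : 0 < R := lt_of_lt_of_le (by positivity) hR
    have hh : 1 / (4 * R) ≤ δ := by
      rw [ge_iff_le, div_le_iff₀ (by positivity)] at hR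
      rw [div_le_iff₀ (by positivity)]
      linarith
    have h1 := hd (1 / (4 * R)) (by positivity) hh
    set B : ℝ := C * (1 / (4 * R)) ^ α
    have hB : 0 ≤ B := by positivity
    have hmeas : MeasurableSet {v : ℝ | R ≤ |v| ∧ |v| < 2 * R} :=
      (measurableSet_le measurable_const measurable_norm).inter
        (measurableSet_lt measurable_norm measurable_const)
    calc ∫⁻ v in {v | R ≤ |v| ∧ |v| < 2 * R}, ‖𝓕 F v‖ₑ ^ 2
        ≤ ∫⁻ v in {v | R ≤ |v| ∧ |v| < 2 * R}, ENNReal.ofReal (B ^ 2) := by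
          refine setLIntegral_mono' hmeas fun v hv => ?_
          obtain ⟨h2, h3⟩ := abs_mul_mem_of_annulus hR0 hv.1 hv.2
          rw [ENNReal.ofReal_pow hB, ← ofReal_norm]
          gcongr
          exact norm_fourier_le_of_eLpNorm_fwdDiff_le hF hB h1 h2 h3
      _ ≤ ENNReal.ofReal (B ^ 2) * ENNReal.ofReal (4 * R) := by
          rw [setLIntegral_const]
          gcongr
          exact volume_annulus_le R
      _ = _ := by
          rw [← ENNReal.ofReal_mul (by positivity)]
          congr 1
          simp only [B]
          rw [one_div, Real.inv_rpow (by positivity), ← Real.rpow_neg (by positivity),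
            Real.mul_rpow (by norm_num) hR0.le,
            show -2 * (α - 1 / 2) = -α + -α + 1 by ring, Real.rpow_add hR0, Real.rpow_add hR0,
            Real.rpow_one]
          ring

theorem samplingRate_of_eLpNorm_one {c α : ℝ} {f : ℝ → ℂ} (hf : ContinuousOn f (Ioi 0))
    (hf1 : MemX c 1 f) (hα : 1 < α) {r : ℕ} {C δ : ℝ} (hC : 0 ≤ C) (hδ : 0 < δ)
    (hd : ∀ h : ℝ, 0 < h → h ≤ δ →
      eLpNorm ((Δ_[h])^[r] (expPullback c f)) 1 volume ≤ ENNReal.ofReal (C * h ^ α)) :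
    SamplingRate c (-α + 1) f := by
  have hF : Integrable (expPullback c f) := memLp_one_iff_integrable.1
    (memLp_expPullback one_ne_zero ENNReal.one_ne_top hf hf1)
  have hG := hasAnnularDecay_fourier hF hC hδ hd
  have h1 : 1 / 2 < α - 1 / 2 := by linarith
  have h2 := samplingRate_of_hasAnnularDecay (c := c) (f := f) h1 hG fun s => ?_
  · convert h2 using 1
    ring
  · have h3 := hF.fourierInv_fourier_eq (hG.integrable h1) (v := s)
      (continuous_expPullback hf).continuousAt
    rw [← h3, Real.fourierInv_eq']
    refine integral_congr_ae (ae_of_all _ fun v => ?_)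
    simp only [smul_eq_mul]
    rw [mul_comm]
    congr 2
    simp
    ring

section

open scoped ContDiff

/-! ### Square integrable functions -/

/-- The `L²` Fourier transform is compatible with the distributional one, so it can be moved onto a
Schwartz test function. -/
lemma integral_schwartz_mul_fourier_L2 (u : Lp ℂ 2 (volume : Measure ℝ)) (φ : SchwartzMap ℝ ℂ) :
    ∫ v, φ v * (𝓕 u : Lp ℂ 2 (volume : Measure ℝ)) v = ∫ s, (𝓕 (φ : ℝ → ℂ)) s * u s := by
  have h := congrArg (fun D : TemperedDistribution ℝ ℂ => D φ)
    (Lp.fourier_toTemperedDistribution_eq u)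
  simp only [TemperedDistribution.fourier_apply, Lp.toTemperedDistribution_apply, smul_eq_mul,
    SchwartzMap.fourier_coe] at h
  exact h.symm

lemma integral_schwartz_mul_eq_fourierInv_L2 (u : Lp ℂ 2 (volume : Measure ℝ)) (φ : SchwartzMap ℝ ℂ) :
    ∫ s, φ s * u s = ∫ v, (𝓕⁻ (φ : ℝ → ℂ)) v * (𝓕 u : Lp ℂ 2 (volume : Measure ℝ)) v := by
  have h := integral_schwartz_mul_fourier_L2 u (𝓕⁻ φ)
  rw [← SchwartzMap.fourier_coe, FourierTransform.fourier_fourierInv_eq] at h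
  rw [← h, SchwartzMap.fourierInv_coe]

/-- The smooth compactly supported function `v ↦ m(v) g(v)` as a Schwartz function. -/
lemma exists_schwartz_eq_mul {g : ℝ → ℝ} (hg : ContDiff ℝ ∞ g) (hgc : HasCompactSupport g)
    {m : ℝ → ℂ} (hm : ContDiff ℝ ∞ m) : ∃ φ : SchwartzMap ℝ ℂ, ∀ v, φ v = m v * g v := by
  have h1 : HasCompactSupport fun v => m v * (g v : ℂ) :=
    (hgc.comp_left (g := ((↑) : ℝ → ℂ)) Complex.ofReal_zero).mul_left
  have h2 : ContDiff ℝ ∞ fun v => m v * (g v : ℂ) :=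
    hm.mul (Complex.ofRealCLM.contDiff.comp hg)
  exact ⟨h1.toSchwartzMap h2, fun v => rfl⟩

lemma locallyIntegrable_of_memLp_two {G : ℝ → ℂ} (hG : MemLp G 2 volume) : LocallyIntegrable G :=
  hG.locallyIntegrable (by norm_num)

lemma contDiff_diffSymbol (h : ℝ) : ContDiff ℝ ∞ (diffSymbol h) := by
  unfold diffSymbol
  have : ContDiff ℝ ∞ fun v : ℝ => (v : ℂ) := Complex.ofRealCLM.contDiff
  fun_prop

lemma memLp_diffSymbol_mul {G : ℝ → ℂ} (hG : MemLp G 2 volume) (h : ℝ) :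
    MemLp (fun v => diffSymbol h v * G v) 2 volume := by
  refine hG.of_le_mul (c := 2) ((continuous_diffSymbol h).aestronglyMeasurable.mul hG.1)
    (ae_of_all _ fun v => ?_)
  rw [norm_mul]
  gcongr
  exact norm_diffSymbol_le h v

lemma memLp_fwdDiff {F : ℝ → ℂ} {p : ℝ≥0∞} (hF : MemLp F p volume) (h : ℝ) :
    MemLp (Δ_[h] F) p volume :=
  (hF.comp_measurePreserving (measurePreserving_add_right volume h)).sub hF

lemma memLp_fwdDiff_iter {F : ℝ → ℂ} {p : ℝ≥0∞} (hF : MemLp F p volume) (h : ℝ) (r : ℕ) :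
    MemLp ((Δ_[h])^[r] F) p volume := by
  induction r with
  | zero => exact hF
  | succ r ih => rw [Function.iterate_succ_apply']; exact memLp_fwdDiff ih h

lemma integrable_schwartz_mul {G : ℝ → ℂ} (hG : MemLp G 2 volume) (φ : SchwartzMap ℝ ℂ) :
    Integrable fun v => φ v * G v :=
  (φ.memLp 2 volume).integrable_mul hG

/-- Proved by testing against smooth compactly supported functions: the symbol is absorbed into the
test function, whose transform then becomes a difference, and a translation moves that difference
onto `F`. -/
lemma fourier_toLp_fwdDiff {F : ℝ → ℂ} (hF : MemLp F 2 volume) (h : ℝ) :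
    (𝓕 ((memLp_fwdDiff hF h).toLp _) : Lp ℂ 2 (volume : Measure ℝ)) =ᵐ[volume]
      fun v => diffSymbol h v * (𝓕 (hF.toLp F) : Lp ℂ 2 (volume : Measure ℝ)) v := by
  refine ae_eq_of_integral_contDiff_smul_eq (locallyIntegrable_of_memLp_two (Lp.memLp _))
    (locallyIntegrable_of_memLp_two (memLp_diffSymbol_mul (Lp.memLp _) h)) fun g hg hgc => ?_
  obtain ⟨φ, hφ⟩ := exists_schwartz_eq_mul hg hgc (m := fun _ => 1) contDiff_const
  obtain ⟨ψ, hψ⟩ := exists_schwartz_eq_mul hg hgc (contDiff_diffSymbol h)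
  have hψφ (v : ℝ) : ψ v = diffSymbol h v * φ v := by rw [hψ, hφ, one_mul]
  have h1 : ∫ v, g v • (𝓕 ((memLp_fwdDiff hF h).toLp _) : Lp ℂ 2 (volume : Measure ℝ)) v =
      ∫ s, 𝓕 (φ : ℝ → ℂ) s * (Δ_[h] F) s := by
    rw [show ∫ s, 𝓕 (φ : ℝ → ℂ) s * (Δ_[h] F) s =
      ∫ s, 𝓕 (φ : ℝ → ℂ) s * ((memLp_fwdDiff hF h).toLp _) s from ?_,
      ← integral_schwartz_mul_fourier_L2]
    · simp [hφ]
    · refine integral_congr_ae ?_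
      filter_upwards [(memLp_fwdDiff hF h).coeFn_toLp] with s hs
      rw [hs]
  have h2 : ∫ v, g v • (diffSymbol h v * (𝓕 (hF.toLp F) : Lp ℂ 2 (volume : Measure ℝ)) v) =
      ∫ s, 𝓕 (ψ : ℝ → ℂ) s * F s := by
    rw [show ∫ s, 𝓕 (ψ : ℝ → ℂ) s * F s =
      ∫ s, 𝓕 (ψ : ℝ → ℂ) s * (hF.toLp F) s from ?_, ← integral_schwartz_mul_fourier_L2]
    · refine integral_congr_ae (ae_of_all _ fun v => ?_)
      simp only [hψ, Complex.real_smul]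
      ring
    · refine integral_congr_ae ?_
      filter_upwards [hF.coeFn_toLp] with s hs
      rw [hs]
  have h3 (s : ℝ) : 𝓕 (ψ : ℝ → ℂ) s = 𝓕 (φ : ℝ → ℂ) (s - h) - 𝓕 (φ : ℝ → ℂ) s := by
    have hint (w : ℝ) : Integrable fun v : ℝ => Real.fourierChar (-(v * w)) • φ v := by
      simpa [mul_comm] using (Real.fourierIntegral_convergent_iff w).2 (φ.integrable (μ := volume))
    rw [Real.fourier_real_eq, Real.fourier_real_eq, Real.fourier_real_eq,
      ← integral_sub (hint _) (hint _)]
    refine integral_congr_ae (ae_of_all _ fun v => ?_)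
    simp only [hψφ, Circle.smul_def, Real.fourierChar_apply, smul_eq_mul, diffSymbol]
    rw [← mul_assoc, mul_sub, mul_one, ← Complex.exp_add, sub_mul]
    congr 3
    push_cast
    ring
  have hFh : MemLp (fun s => F (s + h)) 2 volume :=
    hF.comp_measurePreserving (measurePreserving_add_right volume h)
  rw [h1, h2]
  simp only [fwdDiff, h3, mul_sub, sub_mul]
  have hi1 : Integrable fun s => 𝓕 (φ : ℝ → ℂ) s * F (s + h) := by
    simpa [SchwartzMap.fourier_coe] using integrable_schwartz_mul hFh (𝓕 φ)
  have hi2 : Integrable fun s => 𝓕 (φ : ℝ → ℂ) s * F s := by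
    simpa [SchwartzMap.fourier_coe] using integrable_schwartz_mul hF (𝓕 φ)
  have hi3 : Integrable fun s => 𝓕 (φ : ℝ → ℂ) (s - h) * F s := by
    simpa using hi1.comp_sub_right h
  rw [integral_sub hi1 hi2, integral_sub hi3 hi2]
  congr 1
  rw [← integral_sub_right_eq_self (μ := volume) _ h]
  simp

lemma fourier_toLp_fwdDiff_iter {F : ℝ → ℂ} (hF : MemLp F 2 volume) (h : ℝ) (r : ℕ) :
    (𝓕 ((memLp_fwdDiff_iter hF h r).toLp _) : Lp ℂ 2 (volume : Measure ℝ)) =ᵐ[volume]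
      fun v => diffSymbol h v ^ r * (𝓕 (hF.toLp F) : Lp ℂ 2 (volume : Measure ℝ)) v := by
  induction r with
  | zero => simp
  | succ r ih =>
    have h1 := fourier_toLp_fwdDiff (memLp_fwdDiff_iter hF h r) h
    have h2 : (memLp_fwdDiff_iter hF h (r + 1)).toLp _ =
        (memLp_fwdDiff (memLp_fwdDiff_iter hF h r) h).toLp _ := by
      simp only [Function.iterate_succ_apply']
    rw [h2]
    filter_upwards [h1, ih] with v hv1 hv2
    rw [hv1, hv2, pow_succ']
    ring

lemma lintegral_sq_fourier_le {F : ℝ → ℂ} (hF : MemLp F 2 volume) {r : ℕ} {B h : ℝ} (hB : 0 ≤ B)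
    (hd : eLpNorm ((Δ_[h])^[r] F) 2 volume ≤ ENNReal.ofReal B) {s : Set ℝ}
    (hs : MeasurableSet s) (h1 : ∀ v ∈ s, 1 / 4 ≤ |h * v| ∧ |h * v| ≤ 1 / 2) :
    ∫⁻ v in s, ‖(𝓕 (hF.toLp F) : Lp ℂ 2 (volume : Measure ℝ)) v‖ₑ ^ 2 ≤ ENNReal.ofReal (B ^ 2) := by
  set D := (memLp_fwdDiff_iter hF h r).toLp _
  have h2 : eLpNorm (𝓕 D : Lp ℂ 2 (volume : Measure ℝ)) 2 volume ≤ ENNReal.ofReal B := by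
    rw [← Lp.enorm_def, ← ofReal_norm, Lp.norm_fourier_eq, ofReal_norm, Lp.enorm_def]
    rwa [eLpNorm_congr_ae (memLp_fwdDiff_iter hF h r).coeFn_toLp]
  rw [eLpNorm_eq_lintegral_rpow_enorm_toReal (by norm_num) (by norm_num)] at h2
  simp only [ENNReal.toReal_ofNat, ENNReal.rpow_two, one_div] at h2
  have h3 : ∫⁻ v, ‖(𝓕 D : Lp ℂ 2 (volume : Measure ℝ)) v‖ₑ ^ 2 ≤ ENNReal.ofReal (B ^ 2) := by
    rw [ENNReal.ofReal_pow hB, ← ENNReal.rpow_two (ENNReal.ofReal B)]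
    rwa [← ENNReal.rpow_inv_le_iff (by norm_num)]
  refine le_trans ?_ h3
  refine le_trans ?_ (setLIntegral_le_lintegral s _)
  refine setLIntegral_mono_ae' hs ?_
  filter_upwards [fourier_toLp_fwdDiff_iter hF h r] with v hv hvs
  obtain ⟨h4, h5⟩ := h1 v hvs
  rw [hv]
  gcongr
  rw [← ofReal_norm, ← ofReal_norm, norm_mul, norm_pow]
  refine ENNReal.ofReal_le_ofReal (le_mul_of_one_le_left (norm_nonneg _)
    (one_le_pow₀ (one_le_norm_diffSymbol h4 h5)))

/-- Plancherel bounds the `L²` norm on the annulus directly, so no exponent is lost. -/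
lemma hasAnnularDecay_fourier_L2 {F : ℝ → ℂ} (hF : MemLp F 2 volume) {r : ℕ} {β C δ : ℝ}
    (hC : 0 ≤ C) (hδ : 0 < δ) (hd : ∀ h : ℝ, 0 < h → h ≤ δ →
      eLpNorm ((Δ_[h])^[r] F) 2 volume ≤ ENNReal.ofReal (C * h ^ β)) :
    HasAnnularDecay (𝓕 (hF.toLp F) : Lp ℂ 2 (volume : Measure ℝ)) β := by
  refine ⟨Lp.aestronglyMeasurable _, fun R => ?_, C ^ 2 * (4 ^ (-β)) ^ 2, 1 / (4 * δ),
    by positivity, by positivity, fun R hR => ?_⟩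
  · refine (setLIntegral_le_lintegral _ _).trans_lt ?_
    have h1 := (Lp.memLp (𝓕 (hF.toLp F) : Lp ℂ 2 (volume : Measure ℝ))).2
    rw [eLpNorm_lt_top_iff_lintegral_rpow_enorm_lt_top (by norm_num) (by norm_num)] at h1
    simpa using h1
  · have hR0 : 0 < R := lt_of_lt_of_le (by positivity) hR
    have hh : 1 / (4 * R) ≤ δ := by
      rw [ge_iff_le, div_le_iff₀ (by positivity)] at hR
      rw [div_le_iff₀ (by positivity)]
      linarith
    have hmeas : MeasurableSet {v : ℝ | R ≤ |v| ∧ |v| < 2 * R} :=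
      (measurableSet_le measurable_const measurable_norm).inter
        (measurableSet_lt measurable_norm measurable_const)
    refine (lintegral_sq_fourier_le hF (by positivity) (hd (1 / (4 * R)) (by positivity) hh) hmeas
      fun v hv => abs_mul_mem_of_annulus hR0 hv.1 hv.2).trans (le_of_eq ?_)
    congr 1
    rw [one_div, Real.inv_rpow (by positivity), ← Real.rpow_neg (by positivity),
      Real.mul_rpow (by norm_num) hR0.le, show -2 * β = -β + -β by ring, Real.rpow_add hR0]
    ring

/-- Both sides have the same integrals against test functions, hence agree almost everywhere;
continuity of both makes this hold at every point. -/
lemma eq_fourierInv_of_integrable_fourier_L2 {F : ℝ → ℂ} (hFc : Continuous F)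
    (hF : MemLp F 2 volume) (hG : Integrable (𝓕 (hF.toLp F) : Lp ℂ 2 (volume : Measure ℝ))) (s : ℝ) :
    F s = 𝓕⁻ ((𝓕 (hF.toLp F) : Lp ℂ 2 (volume : Measure ℝ)) : ℝ → ℂ) s := by
  set G : ℝ → ℂ := ⇑(𝓕 (hF.toLp F) : Lp ℂ 2 (volume : Measure ℝ))
  have hcont : Continuous (𝓕⁻ G) := by
    rw [Real.fourierInv_eq_fourier_comp_neg]
    exact VectorFourier.fourierIntegral_continuous Real.continuous_fourierChar (by fun_prop)
      hG.comp_neg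
  have hae : F =ᵐ[volume] 𝓕⁻ G := by
    refine ae_eq_of_integral_contDiff_smul_eq hFc.locallyIntegrable hcont.locallyIntegrable
      fun g hg hgc => ?_
    obtain ⟨φ, hφ⟩ := exists_schwartz_eq_mul hg hgc (m := fun _ => 1) contDiff_const
    have h1 := integral_schwartz_mul_eq_fourierInv_L2 (hF.toLp F) φ
    have h2 : ∫ v, 𝓕⁻ (φ : ℝ → ℂ) v * G v = ∫ s, φ s * 𝓕⁻ G s := by
      have h3 := VectorFourier.integral_fourierIntegral_smul_eq_flip (μ := volume) (ν := volume)
        (L := -innerₗ ℝ) Real.continuous_fourierChar (by fun_prop) φ.integrable hG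
      have h4 : (-innerₗ ℝ).flip = -innerₗ ℝ := by
        ext
        simp
      rw [h4] at h3
      exact h3
    have h3 : ∫ s, φ s * F s = ∫ s, φ s * (hF.toLp F) s := by
      refine integral_congr_ae ?_
      filter_upwards [hF.coeFn_toLp] with s hs
      rw [hs]
    simpa [hφ] using h3.trans (h1.trans h2)
  exact congrFun ((hFc.ae_eq_iff_eq volume hcont).1 hae) s

theorem samplingRate_of_eLpNorm_two {c β : ℝ} {f : ℝ → ℂ} (hf : ContinuousOn f (Ioi 0))
    (hf2 : MemX c 2 f) (hβ : 1 / 2 < β) {r : ℕ} {C δ : ℝ} (hC : 0 ≤ C) (hδ : 0 < δ)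
    (hd : ∀ h : ℝ, 0 < h → h ≤ δ →
      eLpNorm ((Δ_[h])^[r] (expPullback c f)) 2 volume ≤ ENNReal.ofReal (C * h ^ β)) :
    SamplingRate c (-β + 1 / 2) f := by
  have hF := memLp_expPullback (by norm_num) (by norm_num) hf hf2
  have hG := hasAnnularDecay_fourier_L2 hF hC hδ hd
  refine samplingRate_of_hasAnnularDecay hβ hG fun s => ?_
  rw [eq_fourierInv_of_integrable_fourier_L2 (continuous_expPullback hf) hF (hG.integrable hβ) s,
    Real.fourierInv_eq']
  refine integral_congr_ae (ae_of_all _ fun v => ?_)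
  simp only [smul_eq_mul]
  rw [mul_comm]
  congr 2
  simp
  ring

end

/-! ### Differences of functions with an absolutely continuous derivative -/

/-- Hölder on an interval of length `h`, then Tonelli and translation invariance. The hypothesis
`hW` is an inequality, so it covers both `C¹` and absolutely continuous `W`. -/
lemma eLpNorm_fwdDiff_le {p : ℝ≥0∞} (hp1 : 1 ≤ p) (hp : p ≠ ∞) {W w : ℝ → ℂ} (hw : Measurable w)
    (hW : ∀ a b, a ≤ b → ‖W b - W a‖ₑ ≤ ∫⁻ t in Ioc a b, ‖w t‖ₑ) {h : ℝ} (hh : 0 < h) :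
    eLpNorm (Δ_[h] W) p volume ≤ ENNReal.ofReal h * eLpNorm w p volume := by
  have hp0 : p ≠ 0 := (zero_lt_one.trans_le hp1).ne'
  have hp1' : 1 ≤ p.toReal := by
    simpa using ENNReal.toReal_mono hp hp1
  have hpos : 0 < p.toReal := by linarith
  set q := p.toReal with hq
  have h1 (s : ℝ) : ‖(Δ_[h] W) s‖ₑ ^ q ≤
      ENNReal.ofReal h ^ (q - 1) * ∫⁻ t in Ioc 0 h, ‖w (s + t)‖ₑ ^ q := by
    have h2 : ‖(Δ_[h] W) s‖ₑ ≤ ∫⁻ t in Ioc 0 h, ‖w (s + t)‖ₑ := by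
      refine (hW s (s + h) (by linarith)).trans (le_of_eq ?_)
      rw [← lintegral_indicator measurableSet_Ioc, ← lintegral_indicator measurableSet_Ioc,
        ← lintegral_add_left_eq_self _ s]
      refine lintegral_congr fun t => ?_
      simp [indicator, mem_Ioc]
    have h3 := eLpNorm_le_eLpNorm_mul_rpow_measure_univ (μ := volume.restrict (Ioc 0 h)) hp1
      (f := fun t => w (s + t)) (hw.comp (measurable_const_add s)).aestronglyMeasurable
    rw [eLpNorm_one_eq_lintegral_enorm, eLpNorm_eq_lintegral_rpow_enorm_toReal hp0 hp,
      Measure.restrict_apply_univ, Real.volume_Ioc, sub_zero] at h3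
    calc _ ≤ ((∫⁻ t in Ioc 0 h, ‖w (s + t)‖ₑ ^ q) ^ (1 / q) *
          ENNReal.ofReal h ^ (1 / (1 : ℝ≥0∞).toReal - 1 / q)) ^ q := by
            gcongr
            exact h2.trans h3
      _ = _ := by
        rw [ENNReal.mul_rpow_of_nonneg _ _ hpos.le, ← ENNReal.rpow_mul, ← ENNReal.rpow_mul,
          one_div_mul_cancel hpos.ne', ENNReal.rpow_one, mul_comm]
        congr 2
        simp only [ENNReal.toReal_one]
        field_simp
  rw [eLpNorm_eq_lintegral_rpow_enorm_toReal hp0 hp, eLpNorm_eq_lintegral_rpow_enorm_toReal hp0 hp,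
    ← hq]
  have h4 : ∫⁻ s, ‖(Δ_[h] W) s‖ₑ ^ q ≤ ENNReal.ofReal h ^ q * ∫⁻ s, ‖w s‖ₑ ^ q := by
    have hm : Measurable fun x : ℝ × ℝ => ‖w (x.1 + x.2)‖ₑ ^ q := by fun_prop
    calc ∫⁻ s, ‖(Δ_[h] W) s‖ₑ ^ q
        ≤ ∫⁻ s, ENNReal.ofReal h ^ (q - 1) * ∫⁻ t in Ioc 0 h, ‖w (s + t)‖ₑ ^ q :=
          lintegral_mono h1
      _ = ENNReal.ofReal h ^ (q - 1) * ∫⁻ t in Ioc 0 h, ∫⁻ s, ‖w (s + t)‖ₑ ^ q := by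
          rw [lintegral_const_mul _ hm.lintegral_prod_right', lintegral_lintegral_swap hm.aemeasurable]
      _ = ENNReal.ofReal h ^ (q - 1) * (ENNReal.ofReal h * ∫⁻ s, ‖w s‖ₑ ^ q) := by
          congr 1
          have (t : ℝ) : ∫⁻ s, ‖w (s + t)‖ₑ ^ q = ∫⁻ s, ‖w s‖ₑ ^ q :=
            lintegral_add_right_eq_self (fun s => ‖w s‖ₑ ^ q) t
          simp_rw [this]
          rw [setLIntegral_const, Real.volume_Ioc, sub_zero, mul_comm]
      _ = _ := by
          rw [← mul_assoc]
          congr 1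
          nth_rewrite 2 [← ENNReal.rpow_one (ENNReal.ofReal h)]
          rw [← ENNReal.rpow_add _ _ (by simpa using hh) ENNReal.ofReal_ne_top]
          congr 1
          ring
  calc _ ≤ (ENNReal.ofReal h ^ q * ∫⁻ s, ‖w s‖ₑ ^ q) ^ (1 / q) := by gcongr
    _ = _ := by
      rw [ENNReal.mul_rpow_of_nonneg _ _ (by positivity), ← ENNReal.rpow_mul,
        mul_one_div_cancel hpos.ne', ENNReal.rpow_one]

lemma contDiff_fwdDiff_iter {n : WithTop ℕ∞} {U : ℝ → ℂ} (hU : ContDiff ℝ n U) (h : ℝ) (r : ℕ) :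
    ContDiff ℝ n ((Δ_[h])^[r] U) := by
  induction r with
  | zero => exact hU
  | succ r ih =>
    rw [Function.iterate_succ_apply']
    exact (ih.comp (contDiff_id.add contDiff_const)).sub ih

lemma deriv_fwdDiff_iter {U : ℝ → ℂ} (hU : ContDiff ℝ 1 U) (h : ℝ) (r : ℕ) :
    deriv ((Δ_[h])^[r] U) = (Δ_[h])^[r] (deriv U) := by
  induction r with
  | zero => rfl
  | succ r ih =>
    rw [Function.iterate_succ_apply', Function.iterate_succ_apply', ← ih]
    have hd := (contDiff_fwdDiff_iter hU h r).differentiable one_ne_zero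
    ext s
    unfold fwdDiff
    rw [deriv_fun_sub (by fun_prop) (by fun_prop), deriv_comp_add_const]

lemma enorm_sub_le_lintegral_deriv {U : ℝ → ℂ} (hU : ContDiff ℝ 1 U) {a b : ℝ} (hab : a ≤ b) :
    ‖U b - U a‖ₑ ≤ ∫⁻ t in Ioc a b, ‖deriv U t‖ₑ := by
  rw [← intervalIntegral.integral_deriv_eq_sub
    (fun x _ => (hU.differentiable one_ne_zero) x)
    ((hU.continuous_deriv le_rfl).intervalIntegrable _ _), intervalIntegral.integral_of_le hab]
  exact enorm_integral_le_lintegral_enorm _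

/-- Each outer difference is traded for a derivative, which commutes with the remaining differences.
The function being differenced is `C¹` in every such step; `hac` enters only at the last one, for
the top derivative. -/
lemma eLpNorm_fwdDiff_iter_le {p : ℝ≥0∞} (hp1 : 1 ≤ p) (hp : p ≠ ∞) {h : ℝ} (hh : 0 < h) (n : ℕ)
    {U : ℝ → ℂ} (hU : ContDiff ℝ n U)
    (hac : ∀ a b, a ≤ b →
      ‖deriv^[n] U b - deriv^[n] U a‖ₑ ≤ ∫⁻ t in Ioc a b, ‖deriv^[n + 1] U t‖ₑ) :
    eLpNorm ((Δ_[h])^[n + 1] U) p volume ≤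
      ENNReal.ofReal (h ^ (n + 1)) * eLpNorm (deriv^[n + 1] U) p volume := by
  induction n generalizing U with
  | zero => simpa using eLpNorm_fwdDiff_le hp1 hp (measurable_deriv U) hac hh
  | succ n ih =>
    have h1 : ContDiff ℝ 1 U := hU.of_le (by norm_cast; omega)
    have h2 : ContDiff ℝ n (deriv U) := by
      have : ContDiff ℝ (n + 1) U := by exact_mod_cast hU
      exact (contDiff_succ_iff_deriv.1 this).2.2
    have h3 := ih h2 hac
    rw [Function.iterate_succ_apply']
    refine (eLpNorm_fwdDiff_le hp1 hp (w := deriv ((Δ_[h])^[n + 1] U)) (measurable_deriv _)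
      (fun a b hab => enorm_sub_le_lintegral_deriv (contDiff_fwdDiff_iter h1 h _) hab) hh).trans ?_
    rw [deriv_fwdDiff_iter h1, pow_succ', ENNReal.ofReal_mul hh.le, mul_assoc]
    gcongr
    exact h3

/-! ### Mellin derivatives -/

/-- Valid without differentiability: `exp` has the smooth local inverse `log`, so both sides take
the default value 0 at the same points. This lets the Mellin derivative be transported everywhere,
including where it fails to exist. -/
lemma deriv_comp_exp (V : ℝ → ℂ) (s : ℝ) :
    deriv (fun s => V (Real.exp s)) s = Real.exp s * deriv V (Real.exp s) := by
  by_cases hV : DifferentiableAt ℝ V (Real.exp s)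
  · have := hV.hasDerivAt.scomp s (Real.hasDerivAt_exp s)
    rw [show (fun s => V (Real.exp s)) = V ∘ Real.exp from rfl, this.deriv]
    simp
  · have h1 : ¬ DifferentiableAt ℝ (fun s => V (Real.exp s)) s := by
      intro h
      apply hV
      have h2 : DifferentiableAt ℝ ((fun s => V (Real.exp s)) ∘ Real.log) (Real.exp s) := by
        refine DifferentiableAt.comp _ ?_ (Real.differentiableAt_log (Real.exp_pos s).ne')
        rwa [Real.log_exp]
      refine h2.congr_of_eventuallyEq ?_
      filter_upwards [lt_mem_nhds (Real.exp_pos s)] with x hx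
      simp [Real.exp_log hx]
    rw [deriv_zero_of_not_differentiableAt hV, deriv_zero_of_not_differentiableAt h1, mul_zero]

lemma deriv_expPullback (c : ℝ) (u : ℝ → ℂ) :
    deriv (expPullback c u) = expPullback c (mellinDeriv c u) := by
  ext s
  have h1 := deriv_comp_exp (fun h => mellinTranslate c h u (Real.exp s)) 0
  rw [Real.exp_zero, Complex.ofReal_one, one_mul] at h1
  have h2 (t : ℝ) : (Real.exp (c * s) : ℂ) * mellinTranslate c (Real.exp t) u (Real.exp s) =
      expPullback c u (t + s) := by
    rw [mellinTranslate, expPullback, ← Real.exp_add, ← mul_assoc, ← Complex.ofReal_mul,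
      ← Real.exp_mul, ← Real.exp_add]
    congr 3
    ring
  rw [expPullback, mellinDeriv, ← h1, ← deriv_const_mul_field]
  simp_rw [h2]
  rw [deriv_comp_add_const, zero_add]

lemma deriv_iterate_expPullback (c : ℝ) (u : ℝ → ℂ) (n : ℕ) :
    deriv^[n] (expPullback c u) = expPullback c ((mellinDeriv c)^[n] u) := by
  induction n with
  | zero => rfl
  | succ n ih => rw [Function.iterate_succ_apply', Function.iterate_succ_apply', ih,
      deriv_expPullback]

lemma mellinDeriv_eq {c x : ℝ} {u : ℝ → ℂ} (hu : DifferentiableAt ℝ u x) :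
    mellinDeriv c u x = c * u x + x * deriv u x := by
  have h1 : HasDerivAt (fun h : ℝ => ((h ^ c : ℝ) : ℂ)) (c : ℂ) 1 := by
    simpa using (Real.hasDerivAt_rpow_const (x := 1) (p := c) (Or.inl one_ne_zero)).ofReal_comp
  have h2 : HasDerivAt (fun h : ℝ => u (h * x)) (x * deriv u x) 1 := by
    have h3 : HasDerivAt (fun h : ℝ => h * x) x 1 := by simpa using (hasDerivAt_id 1).mul_const x
    have h4 : HasDerivAt u (deriv u x) (1 * x) := by rw [one_mul]; exact hu.hasDerivAt
    simpa [Function.comp_def] using! HasDerivAt.scomp (1 : ℝ) h4 h3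
  have h5 := h1.mul h2
  rw [mellinDeriv]
  refine Eq.trans (HasDerivAt.deriv h5) ?_
  simp

namespace AbsolutelyContinuousOnInterval

lemma congr {X : Type*} [PseudoMetricSpace X] {f g : ℝ → X} {a b : ℝ}
    (hf : AbsolutelyContinuousOnInterval f a b) (h : EqOn f g (uIcc a b)) :
    AbsolutelyContinuousOnInterval g a b := by
  refine Tendsto.congr' ?_ hf
  rw [EventuallyEq, eventually_inf_principal]
  refine Eventually.of_forall fun E hE => Finset.sum_congr rfl fun i hi => ?_
  rw [h (hE.1 i hi).1, h (hE.1 i hi).2]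

lemma comp_lipschitz {X Y : Type*} [PseudoMetricSpace X] [PseudoMetricSpace Y] {f : ℝ → X}
    {a b : ℝ} (hf : AbsolutelyContinuousOnInterval f a b) {φ : X → Y}
    (hφ : ∀ x y, dist (φ x) (φ y) ≤ dist x y) :
    AbsolutelyContinuousOnInterval (fun x => φ (f x)) a b := by
  refine squeeze_zero (fun E => Finset.sum_nonneg fun i _ => dist_nonneg) (fun E => ?_) hf
  exact Finset.sum_le_sum fun i _ => hφ _ _

/-- The fundamental theorem of calculus is applied to real and imaginary parts; their derivatives
recombine into `deriv V` wherever both exist, hence almost everywhere. -/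
lemma enorm_sub_le_lintegral_deriv {V : ℝ → ℂ} {a b : ℝ} (hab : a ≤ b)
    (hV : AbsolutelyContinuousOnInterval V a b) :
    ‖V b - V a‖ₑ ≤ ∫⁻ t in Ioc a b, ‖deriv V t‖ₑ := by
  have hre : AbsolutelyContinuousOnInterval (fun x => (V x).re) a b :=
    hV.comp_lipschitz fun x y => by
      rw [Real.dist_eq, ← Complex.sub_re, Complex.dist_eq]
      exact Complex.abs_re_le_norm _
  have him : AbsolutelyContinuousOnInterval (fun x => (V x).im) a b :=
    hV.comp_lipschitz fun x y => by
      rw [Real.dist_eq, ← Complex.sub_im, Complex.dist_eq]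
      exact Complex.abs_im_le_norm _
  have hint : V b - V a = ∫ t in a..b, (((deriv (fun x => (V x).re) t : ℝ) : ℂ) +
      ((deriv (fun x => (V x).im) t : ℝ) : ℂ) * Complex.I) := by
    have hre' := hre.intervalIntegrable_deriv
    have him' := him.intervalIntegrable_deriv
    have hre'' : IntervalIntegrable (fun t => ((deriv (fun x => (V x).re) t : ℝ) : ℂ))
        volume a b := ⟨hre'.1.ofReal, hre'.2.ofReal⟩
    have him'' : IntervalIntegrable (fun t => ((deriv (fun x => (V x).im) t : ℝ) : ℂ))
        volume a b := ⟨him'.1.ofReal, him'.2.ofReal⟩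
    rw [intervalIntegral.integral_add hre'' (him''.mul_const _), intervalIntegral.integral_mul_const,
      intervalIntegral.integral_ofReal, intervalIntegral.integral_ofReal,
      hre.integral_deriv_eq_sub, him.integral_deriv_eq_sub]
    apply Complex.ext <;> simp
  rw [hint, intervalIntegral.integral_of_le hab]
  refine (enorm_integral_le_lintegral_enorm _).trans (le_of_eq ?_)
  refine setLIntegral_congr_fun_ae measurableSet_Ioc ?_
  filter_upwards [hre.ae_differentiableAt, him.ae_differentiableAt] with t h1 h2 ht
  have ht' : t ∈ uIcc a b := by
    rw [uIcc_of_le hab]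
    exact Ioc_subset_Icc_self ht
  have h3 := (h1 ht').hasDerivAt.ofReal_comp.add
    ((h2 ht').hasDerivAt.ofReal_comp.mul_const Complex.I)
  have h4 : V = (fun x => (((V x).re : ℝ) : ℂ)) + fun x => (((V x).im : ℝ) : ℂ) * Complex.I := by
    ext x
    simp
  have h5 := h3.deriv
  erw [← h4] at h5
  rw [h5]

end AbsolutelyContinuousOnInterval

lemma contDiffOn_iteratedDerivWithin {g : ℝ → ℂ} {s : Set ℝ} (hs : UniqueDiffOn ℝ s) (n : ℕ)
    {m : ℕ} (hg : ContDiffOn ℝ (n + m : ℕ) g s) : ContDiffOn ℝ m (iteratedDerivWithin n g s) s := by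
  induction n generalizing m with
  | zero => simpa using hg
  | succ n ih =>
    rw [iteratedDerivWithin_succ]
    exact (ih (m := m + 1) (by convert hg using 2; omega)).derivWithin hs (by norm_cast)

/-- Since `Θ_c u = c u + x u'`, the top derivative enters only through `x^n g^{(n)}`, and the
remainder is one degree smoother. With `m = 0` this makes `R` of class `C¹`, so absolute continuity
of `g^{(n)}` passes to the iterated Mellin derivative. Each step costs `R` one derivative, hence the
induction over all `m`. -/
lemma exists_mellinDeriv_iterate_eq (c : ℝ) (g : ℝ → ℂ) (n m : ℕ)
    (hg : ContDiffOn ℝ (n + m : ℕ) g (Ioi 0)) :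
    ∃ R : ℝ → ℂ, ContDiffOn ℝ (m + 1 : ℕ) R (Ioi 0) ∧ ∀ x > 0,
      (mellinDeriv c)^[n] g x = (x : ℂ) ^ n * iteratedDerivWithin n g (Ioi 0) x + R x := by
  induction n generalizing m with
  | zero => exact ⟨0, contDiffOn_const, by simp⟩
  | succ n ih =>
    obtain ⟨R, hR, h⟩ := ih (m + 1) (by convert hg using 2; omega)
    set D := iteratedDerivWithin n g (Ioi 0) with hD
    have hDc : ContDiffOn ℝ (m + 1 : ℕ) D (Ioi 0) := by
      exact contDiffOn_iteratedDerivWithin isOpen_Ioi.uniqueDiffOn n (by convert hg using 2; omega)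
    have hx : ContDiff ℝ (m + 1 : ℕ) fun x : ℝ => (x : ℂ) := Complex.ofRealCLM.contDiff
    have hR' : ContDiffOn ℝ (m + 1 : ℕ) (deriv R) (Ioi 0) :=
      hR.deriv_of_isOpen isOpen_Ioi (by norm_cast)
    refine ⟨fun x => (c + n) * (x : ℂ) ^ n * D x + c * R x + x * deriv R x, ?_, fun x hx0 => ?_⟩
    · refine ((((contDiff_const.mul (hx.pow n)).contDiffOn).mul hDc).add ?_).add
        (hx.contDiffOn.mul hR')
      exact contDiffOn_const.mul (hR.of_le (by norm_cast; omega))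
    · have hev : (mellinDeriv c)^[n] g =ᶠ[𝓝 x] fun y => (y : ℂ) ^ n * D y + R y := by
        filter_upwards [lt_mem_nhds hx0] with y hy using h y hy
      have hDd : HasDerivAt D (iteratedDerivWithin (n + 1) g (Ioi 0) x) x := by
        rw [iteratedDerivWithin_succ, derivWithin_of_isOpen isOpen_Ioi hx0]
        exact ((hDc.differentiableOn (by norm_cast)).differentiableAt
          (Ioi_mem_nhds hx0)).hasDerivAt
      have hRd : HasDerivAt R (deriv R x) x :=
        ((hR.differentiableOn (by norm_cast)).differentiableAt (Ioi_mem_nhds hx0)).hasDerivAt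
      have hpow : HasDerivAt (fun y : ℝ => (y : ℂ) ^ n) (n * (x : ℂ) ^ (n - 1)) x := by
        simpa using! (hasDerivAt_id x).ofReal_comp.pow n
      have hd : HasDerivAt ((mellinDeriv c)^[n] g) (n * (x : ℂ) ^ (n - 1) * D x +
          (x : ℂ) ^ n * iteratedDerivWithin (n + 1) g (Ioi 0) x + deriv R x) x :=
        ((hpow.mul hDd).add hRd).congr_of_eventuallyEq hev
      rw [Function.iterate_succ_apply', mellinDeriv_eq hd.differentiableAt, hd.deriv, h x hx0]
      rcases n with _ | n
      · simp
        ring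
      · simp only [Nat.add_sub_cancel]
        push_cast
        ring

lemma contDiff_expPullback {n : ℕ} {g : ℝ → ℂ} (hg : ContDiffOn ℝ n g (Ioi 0)) (c : ℝ) :
    ContDiff ℝ n (expPullback c g) := by
  unfold expPullback
  have h1 : ContDiff ℝ n fun s : ℝ => (Real.exp (c * s) : ℂ) :=
    Complex.ofRealCLM.contDiff.comp (Real.contDiff_exp.comp (contDiff_const.mul contDiff_id))
  exact h1.mul (hg.comp_contDiff Real.contDiff_exp fun s => Real.exp_pos s)

/-- Absolute continuity is checked in the variable `x`, for `V(x) = x^c (Θ_c^n g)(x)`, a combination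
of smooth factors, `g^{(n)}` and a `C¹` remainder. The substitution `x = e^t` is made only in the
resulting integral. -/
lemma enorm_iterate_deriv_expPullback_sub_le {n : ℕ} {g : ℝ → ℂ}
    (hg : ContDiffOn ℝ n g (Ioi 0)) (hac : ∀ a b : ℝ, 0 < a → a < b →
      AbsolutelyContinuousOnInterval (iteratedDerivWithin n g (Ioi 0)) a b) (c : ℝ) {a b : ℝ}
    (hab : a ≤ b) :
    ‖deriv^[n] (expPullback c g) b - deriv^[n] (expPullback c g) a‖ₑ ≤
      ∫⁻ t in Ioc a b, ‖deriv^[n + 1] (expPullback c g) t‖ₑ := by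
  rcases hab.eq_or_lt with rfl | hab
  · simp
  obtain ⟨R, hR, h⟩ := exists_mellinDeriv_iterate_eq c g n 0 hg
  set V : ℝ → ℂ := fun x => ((x ^ c : ℝ) : ℂ) * (mellinDeriv c)^[n] g x with hV
  have hVexp (s : ℝ) : deriv^[n] (expPullback c g) s = V (Real.exp s) := by
    rw [deriv_iterate_expPullback, expPullback, hV, mul_comm c, Real.exp_mul]
  have hexp : Real.exp a < Real.exp b := Real.exp_lt_exp.2 hab
  have hpos : uIcc (Real.exp a) (Real.exp b) ⊆ Ioi 0 := by
    rw [uIcc_of_le hexp.le]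
    exact fun x hx => (Real.exp_pos a).trans_le hx.1
  have hVac : AbsolutelyContinuousOnInterval V (Real.exp a) (Real.exp b) := by
    have h1 : AbsolutelyContinuousOnInterval (fun x : ℝ => ((x ^ c : ℝ) : ℂ))
        (Real.exp a) (Real.exp b) := by
      refine ContDiffOn.absolutelyContinuousOnInterval ?_
      refine Complex.ofRealCLM.contDiff.comp_contDiffOn fun x hx => ?_
      exact (Real.contDiffAt_rpow_const_of_ne (hpos hx).ne').contDiffWithinAt
    have h2 : AbsolutelyContinuousOnInterval (fun x : ℝ => (x : ℂ) ^ n)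
        (Real.exp a) (Real.exp b) :=
      ContDiffOn.absolutelyContinuousOnInterval
        ((Complex.ofRealCLM.contDiff (n := 1)).pow n).contDiffOn
    have h3 : AbsolutelyContinuousOnInterval R (Real.exp a) (Real.exp b) :=
      ContDiffOn.absolutelyContinuousOnInterval ((hR.of_le (by norm_num)).mono hpos)
    refine (h1.smul ((h2.smul (hac _ _ (Real.exp_pos a) hexp)).add h3)).congr fun x hx => ?_
    simp only [hV, h x (hpos hx), Pi.smul_apply', Pi.add_apply, Pi.mul_apply, smul_eq_mul]
  have himage : Real.exp '' Ioc a b = Ioc (Real.exp a) (Real.exp b) :=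
    Real.continuous_exp.image_Ioc_of_strictMono Real.exp_strictMono
  rw [hVexp, hVexp, Function.iterate_succ_apply', funext hVexp]
  refine (hVac.enorm_sub_le_lintegral_deriv hexp.le).trans (le_of_eq ?_)
  rw [← himage, lintegral_image_eq_lintegral_abs_deriv_mul measurableSet_Ioc
    (fun x _ => (Real.hasDerivAt_exp x).hasDerivWithinAt) Real.exp_injective.injOn]
  refine lintegral_congr fun t => ?_
  rw [deriv_comp_exp, enorm_mul, abs_of_pos (Real.exp_pos t), ← ofReal_norm (Real.exp t : ℂ),
    Complex.norm_real, Real.norm_of_nonneg (Real.exp_pos t).le]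

/-- The logarithm is differentiable on the half-line, so it maps null sets to null sets. -/
lemma expPullback_ae_eq {f g : ℝ → ℂ} (h : f =ᵐ[volume.restrict (Ioi 0)] g) (c : ℝ) :
    expPullback c f =ᵐ[volume] expPullback c g := by
  rw [EventuallyEq, ae_restrict_iff' measurableSet_Ioi, ae_iff] at h
  have h1 := addHaar_image_eq_zero_of_differentiableOn_of_addHaar_eq_zero volume (f := Real.log)
    (s := {x | ¬(x ∈ Ioi 0 → f x = g x)}) (fun x hx => by
      have : 0 < x := by
        by_contra hx'
        exact hx fun h => absurd h hx'
      exact (Real.differentiableAt_log this.ne').differentiableWithinAt) h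
  rw [EventuallyEq, ae_iff]
  refine measure_mono_null (fun s hs => ?_) h1
  refine ⟨Real.exp s, fun h2 => hs ?_, Real.log_exp s⟩
  rw [expPullback, expPullback, h2 (Real.exp_pos s)]

lemma fwdDiff_iter_ae_eq {F F' : ℝ → ℂ} (h : F =ᵐ[volume] F') (t : ℝ) (r : ℕ) :
    (Δ_[t])^[r] F =ᵐ[volume] (Δ_[t])^[r] F' := by
  induction r with
  | zero => exact h
  | succ r ih =>
    rw [Function.iterate_succ_apply', Function.iterate_succ_apply']
    exact ((measurePreserving_add_right volume t).quasiMeasurePreserving.ae_eq_comp ih).sub ih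

/-- The norm of a difference depends only on the almost-everywhere class, so `f` may be replaced by
its regular representative `g`; the constant is the `X^p_c` norm of `Θ_c^r g`, with no restriction
on the step. -/
lemma MellinSampling.MemW.exists_eLpNorm_fwdDiff_le {r : ℕ} {c : ℝ} {p : ℝ≥0∞} (hr : 1 ≤ r)
    (hp1 : 1 ≤ p) (hp : p ≠ ⊤) {f : ℝ → ℂ} (hf : MemW r c p f) :
    ∃ C : ℝ, 0 ≤ C ∧ ∀ h : ℝ, 0 < h →
      eLpNorm ((Δ_[h])^[r] (expPullback c f)) p volume ≤ ENNReal.ofReal (C * h ^ (r : ℝ)) := by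
  obtain ⟨-, g, hfg, hg, hac, hX⟩ := hf
  obtain ⟨n, rfl⟩ : ∃ n, r = n + 1 := ⟨r - 1, by omega⟩
  rw [Nat.add_sub_cancel] at hg hac
  have hp0 : p ≠ 0 := (zero_lt_one.trans_le hp1).ne'
  have hfin : eLpNorm (deriv^[n + 1] (expPullback c g)) p volume ≠ ⊤ := by
    rw [deriv_iterate_expPullback, ← normX_eq_eLpNorm c hp0 hp]
    exact hX.2.ne
  refine ⟨(eLpNorm (deriv^[n + 1] (expPullback c g)) p volume).toReal, ENNReal.toReal_nonneg,
    fun h hh => ?_⟩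
  rw [eLpNorm_congr_ae (fwdDiff_iter_ae_eq (expPullback_ae_eq hfg c) h (n + 1))]
  refine (eLpNorm_fwdDiff_iter_le hp1 hp hh n (contDiff_expPullback hg c) fun a b hab =>
    enorm_iterate_deriv_expPullback_sub_le hg hac c hab).trans (le_of_eq ?_)
  rw [ENNReal.ofReal_mul ENNReal.toReal_nonneg, ENNReal.ofReal_toReal hfin, Real.rpow_natCast,
    mul_comm]

/-! ### The four cases -/

theorem theorem7 (c : ℝ) :
    (∀ (r : ℕ) (α : ℝ) (f : ℝ → ℂ), 2 ≤ r → 1 < α → α ≤ r →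
      MemC f → MemLip r α c 1 f → SamplingRate c (-α + 1) f) ∧
    (∀ (r : ℕ) (β : ℝ) (f : ℝ → ℂ), 1 / 2 < β → β ≤ r →
      MemM2 c f → MemLip r β c 2 f → SamplingRate c (-β + 1 / 2) f) ∧
    (∀ (r : ℕ) (f : ℝ → ℂ), 1 < r →
      MemM1 c f → MemW r c 1 f → SamplingRate c (-(r : ℝ) + 1) f) ∧
    (∀ (r : ℕ) (f : ℝ → ℂ), (1 / 2 : ℝ) < r →
      MemM2 c f → MemW r c 2 f → SamplingRate c (-(r : ℝ) + 1 / 2) f) := by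
  refine ⟨fun r α f _ hα _ hf hL => ?_, fun r β f hβ _ hf hL => ?_, fun r f hr hf hW => ?_,
    fun r f hr hf hW => ?_⟩
  · obtain ⟨C, hC, δ, hδ, h⟩ := hL.exists_eLpNorm_fwdDiff_le one_ne_zero ENNReal.one_ne_top
    exact samplingRate_of_eLpNorm_one hf.1.continuousOn hL.1 hα hC hδ h
  · obtain ⟨C, hC, δ, hδ, h⟩ := hL.exists_eLpNorm_fwdDiff_le two_ne_zero ENNReal.ofNat_ne_top
    exact samplingRate_of_eLpNorm_two hf.2.1.1.continuousOn hL.1 hβ hC hδ h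
  · obtain ⟨C, hC, h⟩ := hW.exists_eLpNorm_fwdDiff_le hr.le le_rfl ENNReal.one_ne_top
    exact samplingRate_of_eLpNorm_one hf.2.1.1.continuousOn hf.1 (by exact_mod_cast hr) hC one_pos
      fun t ht _ => h t ht
  · have hr1 : 1 ≤ r := by
      rcases r with _ | r
      · norm_num at hr
      · omega
    obtain ⟨C, hC, h⟩ := hW.exists_eLpNorm_fwdDiff_le hr1 one_le_two ENNReal.ofNat_ne_top
    exact samplingRate_of_eLpNorm_two hf.2.1.1.continuousOn hf.1 hr hC one_pos fun t ht _ => h t ht
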